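/- For integers $r\ge 1$ and $n>2r$, let $\nu$ be the standard normal distribution on $\mathbb{R}$ and, for $x=(x_1,\dots,x_n)\in\mathbb{R}^n$, put $$H_n(x)=-\frac{1}{2r}\sum_{i=1}^n\sum_{j=1}^{r}x_ix_{i+j},\qquad T_n(x)=\frac{x_1^2+\cdots+x_n^2}{n},\qquad S_n(x)=x_1+\cdots+x_n,$$ with the periodic convention $x_{n+k}=x_k$ for $1\le k\le n$. Let $\mu_n$ be the probability measure on $\mathbb{R}^n$ given by $$d\mu_n(x)=\frac{1}{Z_n}\exp\left(-\frac{H_n(x)}{T_n(x)}\right)\mathbf{1}_{\{T_n(x)>0\}}\prod_{i=1}^n d\nu(x_i),$$ where $Z_n$ is the normalization constant. **Theorem.** For every fixed integer $r\ge 1$, the equation $$\int_0^1\left(\frac{1}{\sigma^2}+1-\frac1r\sum_{m=1}^r\cos(2\pi mt)\right)^{-1}dt=1$$ has exactly one solution $\sigma=\sigma_r$ in $(0,\infty)$, and, as $n\to\infty$, the law of $S_n/\sqrt n$ under $\mu_n$ converges in distribution to the normal law $\mathcal{N}(0,\sigma_r^2)$ with mean $0$ and variance $\sigma_r^2$. For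 $r=1$ one has $\sigma_1^2=\sqrt2+1$. -/

import Mathlib

open MeasureTheory ProbabilityTheory Filter Topology
open scoped ENNReal NNReal

namespace SpinChain

noncomputable section

/-- The Hamiltonian of range `r` of a chain of `n` real spins with periodic boundary conditions,
`H_n(x) = -(1 / (2 r)) ∑_{i} ∑_{j = 1}^{r} x_i x_{i + j}`, the index `i + j` being read mod `n`. -/
def hamiltonian (r n : ℕ) (x : Fin n → ℝ) : ℝ :=
  -(1 / (2 * (r : ℝ))) * ∑ i : Fin n, ∑ j ∈ Finset.Icc 1 r,
    x i * x ⟨((i : ℕ) + j) % n, Nat.mod_lt _ i.pos⟩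

/-- The self-adjusted temperature `T_n(x) = (x_1² + ⋯ + x_n²) / n`. -/
def temperature (n : ℕ) (x : Fin n → ℝ) : ℝ :=
  (∑ i : Fin n, x i ^ 2) / (n : ℝ)

/-- The magnetization `S_n(x) = x_1 + ⋯ + x_n`. -/
def magnetization (n : ℕ) (x : Fin n → ℝ) : ℝ :=
  ∑ i : Fin n, x i

/-- The law `ν^{⊗ n}` of `n` independent standard normal variables. -/
def gaussianProduct (n : ℕ) : Measure (Fin n → ℝ) :=
  Measure.pi fun _ : Fin n => gaussianReal 0 1

/-- The unnormalized density `exp (-H_n / T_n) 1_{T_n > 0}` of the model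
with respect to `ν^{⊗ n}`. -/
def weight (r n : ℕ) : (Fin n → ℝ) → ℝ :=
  {x | 0 < temperature n x}.indicator
    fun x => Real.exp (-(hamiltonian r n x) / temperature n x)

/-- The normalization constant `Z_n`. -/
def partitionFunction (r n : ℕ) : ℝ≥0∞ :=
  ∫⁻ x, ENNReal.ofReal (weight r n x) ∂(gaussianProduct n)

/-- The law `μ_n` of the spins, with interaction range `r`. -/
def spinLaw (r n : ℕ) : Measure (Fin n → ℝ) :=
  (partitionFunction r n)⁻¹ •
    (gaussianProduct n).withDensity fun x => ENNReal.ofReal (weight r n x)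

/-- The equation `∫_0^1 (1/σ² + 1 - (1/r) ∑_{m=1}^r cos (2π m t))⁻¹ dt = 1`. -/
def VarianceEquation (r : ℕ) (σ : ℝ) : Prop :=
  ∫ t in (0 : ℝ)..1,
    (1 / σ ^ 2 + 1 - 1 / (r : ℝ) * ∑ m ∈ Finset.Icc 1 r, Real.cos (2 * Real.pi * m * t))⁻¹ = 1

/-! `μ_n` is a probability measure as soon as there is at least one spin. -/

lemma sum_sq_eq {n : ℕ} (hn : 0 < n) (x : Fin n → ℝ) :
    ∑ i : Fin n, x i ^ 2 = n * temperature n x := by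
  unfold temperature
  field_simp

lemma neg_hamiltonian_le {r n : ℕ} (hn : 0 < n) (x : Fin n → ℝ) :
    -(hamiltonian r n x) ≤ (1 / (2 * (r : ℝ)) * (n * (r * n))) * temperature n x := by
  have hs := sum_sq_eq hn x
  have key : ∀ i k : Fin n, x i * x k ≤ n * temperature n x := by
    intro i k
    have h1 : x i ^ 2 ≤ ∑ i : Fin n, x i ^ 2 :=
      Finset.single_le_sum (f := fun i => x i ^ 2) (fun i _ => sq_nonneg _) (Finset.mem_univ i)
    have h2 : x k ^ 2 ≤ ∑ i : Fin n, x i ^ 2 :=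
      Finset.single_le_sum (f := fun i => x i ^ 2) (fun i _ => sq_nonneg _) (Finset.mem_univ k)
    nlinarith [sq_nonneg (x i - x k)]
  have h3 : ∑ i : Fin n, ∑ j ∈ Finset.Icc 1 r,
      x i * x ⟨((i : ℕ) + j) % n, Nat.mod_lt _ i.pos⟩
      ≤ ∑ _i : Fin n, ∑ _j ∈ Finset.Icc 1 r, n * temperature n x :=
    Finset.sum_le_sum fun i _ => Finset.sum_le_sum fun j _ => key _ _
  have h4 : ∑ _i : Fin n, ∑ _j ∈ Finset.Icc 1 r, n * temperature n x
      = n * (r * (n * temperature n x)) := by simp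
  rw [h4] at h3
  have h5 : (0 : ℝ) ≤ 1 / (2 * (r : ℝ)) := by positivity
  have h6 := mul_le_mul_of_nonneg_left h3 h5
  unfold hamiltonian
  linarith

lemma measurable_weight (r n : ℕ) : Measurable (weight r n) := by
  have hT : Measurable (temperature n) := by unfold temperature; fun_prop
  have hH : Measurable (hamiltonian r n) := by unfold hamiltonian; fun_prop
  exact ((hH.neg.div hT).exp).indicator (measurableSet_lt measurable_const hT)

instance (n : ℕ) : IsProbabilityMeasure (gaussianProduct n) := by
  unfold gaussianProduct; infer_instance

lemma partitionFunction_ne_top {r n : ℕ} (hn : 0 < n) : partitionFunction r n ≠ ⊤ := by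
  have hb : ∀ x, ENNReal.ofReal (weight r n x)
      ≤ ENNReal.ofReal (Real.exp (1 / (2 * (r : ℝ)) * (n * (r * n)))) := by
    intro x
    apply ENNReal.ofReal_le_ofReal
    unfold weight
    refine Set.indicator_le' (fun x hx => ?_) (fun x _ => (Real.exp_pos _).le) x
    exact Real.exp_le_exp.2 ((div_le_iff₀ hx).2 (neg_hamiltonian_le hn x))
  refine ne_of_lt ((lintegral_mono hb).trans_lt ?_)
  simp

lemma partitionFunction_ne_zero {r n : ℕ} (hn : 0 < n) : partitionFunction r n ≠ 0 := by
  intro h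
  unfold partitionFunction at h
  rw [lintegral_eq_zero_iff (measurable_weight r n).ennreal_ofReal] at h
  have : Nonempty (Fin n) := ⟨⟨0, hn⟩⟩
  have h0 : ∀ᵐ x ∂(gaussianProduct n), x ≠ 0 := by
    have : NullSingletonClass (gaussianReal 0 1) := nullSingletonClass_gaussianReal one_ne_zero
    have h1 : gaussianProduct n {0} = 0 := by
      unfold gaussianProduct
      rw [Measure.pi_singleton]
      exact Finset.prod_eq_zero (Finset.mem_univ ⟨0, hn⟩) (measure_singleton _)
    simpa [ae_iff] using h1
  obtain ⟨x, hx, hx0⟩ := (h.and h0).exists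
  apply hx0
  by_contra hne
  have hpos : 0 < temperature n x := by
    obtain ⟨i, hi⟩ := Function.ne_iff.1 hne
    have : 0 < x i ^ 2 := by
      have : x i ≠ 0 := hi
      positivity
    unfold temperature
    refine div_pos (this.trans_le ?_) (by exact_mod_cast hn)
    exact Finset.single_le_sum (f := fun i => x i ^ 2) (fun i _ => sq_nonneg _)
      (Finset.mem_univ i)
  have hw : 0 < weight r n x := by
    unfold weight
    rw [Set.indicator_of_mem (show x ∈ {x | 0 < temperature n x} from hpos)]
    exact Real.exp_pos _
  have : ENNReal.ofReal (weight r n x) = 0 := hx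
  rw [ENNReal.ofReal_eq_zero] at this
  linarith

lemma isProbabilityMeasure_spinLaw {r n : ℕ} (hn : 0 < n) :
    IsProbabilityMeasure (spinLaw r n) := by
  refine ⟨?_⟩
  rw [spinLaw, Measure.smul_apply, withDensity_apply _ MeasurableSet.univ, setLIntegral_univ,
    smul_eq_mul]
  exact ENNReal.inv_mul_cancel (partitionFunction_ne_zero hn) (partitionFunction_ne_top hn)

instance {r : ℕ} (n : Set.Ioi (2 * r)) : IsProbabilityMeasure (spinLaw r n) :=
  isProbabilityMeasure_spinLaw (lt_of_le_of_lt (Nat.zero_le _) n.2)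

end

end SpinChain

/-!
The proof combines an exact identity for the law of `S_n / √n` with second moment estimates; it
needs neither a local limit theorem nor a saddle point analysis of the partition function.

The matrix of the interaction is circulant, so the Hartley matrix `hartley` diagonalizes it with
eigenvalues `a(k / n)`, where `a` is the function `symbol`, and `S_n / √n` is the Hartley coordinate
of index `0`. Let `s > 1` and let `w(x) = s + 2 H_n(x) / |x|²` (`formRatio`), which depends only on
the direction of `x`. Since `-H_n / T_n = (n / 2) (s - w)`, rescaling each ray by `√w` turns the
density `exp (-H_n / T_n - |x|² / 2)` into
`w ^ (n / 2) exp ((n / 2) (s - w)) exp (-w |x|² / 2)`, and `w |x|²` is the quadratic form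
`s |x|² + 2 H_n(x)`. Its Hartley coordinates have variances `b_k = 1 / (s - a(k / n))`, and in terms
of the standard Gaussian vector `z` of the normalized coordinates
one has `w = ∑ z_k² / ∑ b_k z_k²`, and the law of `S_n / √n` is that of `√w √b_0 z_0` under the
Gaussian law weighted by `exp ((n / 2) (log w - w + 1))`. This weight is at most `1`
(`density_transform`, `integral_spinLaw_eq`).

Choose `s = 1 + 1 / σ²` with `∫_0^1 (s - a(t))⁻¹ dt = 1`. A Riemann sum estimate shows that
`∑ (1 - b_k)` is bounded, so that `√n (w - 1)` is bounded in `L²`, uniformly in `n`. Hence the total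
mass of the weight stays away from `0`. Overwriting `z_0` by `1` changes the weight by
`O(1 / √n)` in mean and makes it independent of `z_0`, and `√w` is within `O(1 / √n)` of `1`.
Therefore expectations of bounded Lipschitz functions of `S_n / √n` converge to those of `√b_0 z_0`,
whose variance is `b_0 = 1 / (s - 1) = σ²` (`exists_abs_tilted_sub_le`).

The integral is strictly decreasing in `s`, is at most `1` at `s = 2`, and diverges as `s` decreases
to `1` because `1 - a(t) = O(t²)`; this yields existence and uniqueness of `σ`. For `r = 1` it is
the integral of a Poisson kernel.
-/

namespace SpinChain

noncomputable section

/-! ### The Hartley transform diagonalizes the Hamiltonian -/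

/-- The function `cas θ = cos θ + sin θ` of the Hartley transform. -/
def cas (θ : ℝ) : ℝ := Real.cos θ + Real.sin θ

/-- The `n × n` Hartley matrix `H i k = cas (2π i k / n) / √n`, the real analogue of the discrete
Fourier transform; it is orthogonal and symmetric. -/
def hartley (n : ℕ) : Matrix (Fin n) (Fin n) ℝ :=
  Matrix.of fun i k => cas (2 * Real.pi * (i : ℕ) * (k : ℕ) / n) / Real.sqrt n

lemma cas_mul_cas (α β : ℝ) : cas α * cas β = Real.cos (α - β) + Real.sin (α + β) := by
  unfold cas
  rw [Real.cos_sub, Real.sin_add]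
  ring

lemma cas_add_add_cas_sub (α β : ℝ) : cas (α + β) + cas (α - β) = 2 * Real.cos β * cas α := by
  unfold cas
  rw [Real.cos_sub, Real.sin_add, Real.cos_add, Real.sin_sub]
  ring

lemma cas_add_int_mul_two_pi (θ : ℝ) (m : ℤ) : cas (θ + m * (2 * Real.pi)) = cas θ := by
  unfold cas
  rw [Real.cos_add_int_mul_two_pi, Real.sin_add_int_mul_two_pi]

lemma sum_range_cexp {n : ℕ} (hn : 0 < n) (m : ℤ) (hm : ¬ (n : ℤ) ∣ m) :
    ∑ i ∈ Finset.range n, Complex.exp (((2 * Real.pi * i * m / n : ℝ) : ℂ) * Complex.I) = 0 := by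
  have hn' : (n : ℂ) ≠ 0 := by exact_mod_cast hn.ne'
  set ω := Complex.exp (((2 * Real.pi * m / n : ℝ) : ℂ) * Complex.I) with hω
  have h1 : ∀ i ∈ Finset.range n,
      Complex.exp (((2 * Real.pi * i * m / n : ℝ) : ℂ) * Complex.I) = ω ^ i := by
    intro i _
    rw [hω, ← Complex.exp_nat_mul]
    congr 1
    push_cast
    ring
  rw [Finset.sum_congr rfl h1]
  have h2 : ω ^ n = 1 := by
    rw [hω, ← Complex.exp_nat_mul, Complex.exp_eq_one_iff]
    refine ⟨m, ?_⟩
    push_cast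
    field_simp
  have h3 : ω ≠ 1 := by
    intro h
    rw [hω, Complex.exp_eq_one_iff] at h
    obtain ⟨k, hk⟩ := h
    apply hm
    refine ⟨k, ?_⟩
    have hpi : (Real.pi : ℂ) ≠ 0 := by exact_mod_cast Real.pi_ne_zero
    push_cast at hk
    have : (m : ℂ) = n * k := by
      field_simp at hk
      have h4 := mul_left_cancel₀ Complex.I_ne_zero (a := Complex.I) (b := (m : ℂ)) (c := n * k)
      apply h4
      linear_combination Complex.I * hk
    exact_mod_cast this
  have h4 := geom_sum_mul ω n
  rw [h2, sub_self] at h4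
  exact (mul_eq_zero.1 h4).resolve_right (sub_ne_zero.2 h3)

lemma sum_range_cos {n : ℕ} (hn : 0 < n) (m : ℤ) :
    ∑ i ∈ Finset.range n, Real.cos (2 * Real.pi * i * m / n) =
      if (n : ℤ) ∣ m then (n : ℝ) else 0 := by
  split_ifs with hm
  · obtain ⟨k, rfl⟩ := hm
    rw [Finset.sum_congr rfl (g := fun _ => (1 : ℝ))]
    · simp
    · intro i _
      have hn' : (n : ℝ) ≠ 0 := by exact_mod_cast hn.ne'
      rw [Real.cos_eq_one_iff]
      refine ⟨i * k, ?_⟩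
      push_cast
      field_simp
  · have h := congrArg Complex.re (sum_range_cexp hn m hm)
    simpa only [Complex.re_sum, Complex.exp_ofReal_mul_I_re, Complex.zero_re] using h

lemma sum_range_sin {n : ℕ} (hn : 0 < n) (m : ℤ) :
    ∑ i ∈ Finset.range n, Real.sin (2 * Real.pi * i * m / n) = 0 := by
  by_cases hm : (n : ℤ) ∣ m
  · obtain ⟨k, rfl⟩ := hm
    refine Finset.sum_eq_zero fun i _ => ?_
    have hn' : (n : ℝ) ≠ 0 := by exact_mod_cast hn.ne'
    rw [Real.sin_eq_zero_iff]
    refine ⟨i * k * 2, ?_⟩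
    push_cast
    field_simp
  · have h := congrArg Complex.im (sum_range_cexp hn m hm)
    simpa only [Complex.im_sum, Complex.exp_ofReal_mul_I_im, Complex.zero_im] using h

lemma hartley_mul_self {n : ℕ} (hn : 0 < n) : hartley n * hartley n = 1 := by
  have hn' : (n : ℝ) ≠ 0 := by exact_mod_cast hn.ne'
  ext k l
  have hs : Real.sqrt n * Real.sqrt n = n := Real.mul_self_sqrt (by positivity)
  have h1 : ∀ i : Fin n, hartley n k i * hartley n i l =
      (Real.cos (2 * Real.pi * (i : ℕ) * ((k : ℤ) - (l : ℤ) : ℤ) / n)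
        + Real.sin (2 * Real.pi * (i : ℕ) * ((k : ℤ) + (l : ℤ) : ℤ) / n)) / n := by
    intro i
    simp only [hartley, Matrix.of_apply]
    rw [div_mul_div_comm, hs, cas_mul_cas]
    congr 3 <;> push_cast <;> ring
  rw [Matrix.mul_apply, Finset.sum_congr rfl fun i _ => h1 i, ← Finset.sum_div,
    Fin.sum_univ_eq_sum_range (fun i =>
        Real.cos (2 * Real.pi * (i : ℕ) * ((k : ℤ) - (l : ℤ) : ℤ) / n)
        + Real.sin (2 * Real.pi * (i : ℕ) * ((k : ℤ) + (l : ℤ) : ℤ) / n)),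
    Finset.sum_add_distrib, sum_range_cos hn, sum_range_sin hn, add_zero, Matrix.one_apply]
  by_cases hkl : k = l
  · simp [hkl, hn']
  · rw [if_neg hkl, if_neg, zero_div]
    intro hd
    have hk := k.2
    have hl := l.2
    apply hkl
    have := Int.eq_zero_of_abs_lt_dvd hd (by rw [abs_lt]; omega)
    ext
    omega

lemma hartley_transpose (n : ℕ) : (hartley n).transpose = hartley n := by
  ext i k
  simp only [hartley, Matrix.transpose_apply, Matrix.of_apply]
  congr 2
  ring

lemma det_hartley_ne_zero {n : ℕ} (hn : 0 < n) : (hartley n).det ≠ 0 := by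
  intro h
  have := congrArg Matrix.det (hartley_mul_self hn)
  simp [h] at this

lemma sum_sq_hartley_mulVec {n : ℕ} (hn : 0 < n) (y : Fin n → ℝ) :
    ∑ i, ((hartley n).mulVec y i) ^ 2 = ∑ k, y k ^ 2 := by
  have h : ((hartley n).mulVec y) ⬝ᵥ ((hartley n).mulVec y) = y ⬝ᵥ y := by
    rw [Matrix.dotProduct_mulVec, ← Matrix.mulVec_transpose, hartley_transpose,
      Matrix.mulVec_mulVec, hartley_mul_self hn, Matrix.one_mulVec]
  simpa only [dotProduct, ← sq] using h

/-- Column `0` of the Hartley matrix is constant, so the magnetization is a multiple of the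
Hartley coordinate of index `0`. -/
lemma magnetization_hartley_mulVec {n : ℕ} (hn : 0 < n) (y : Fin n → ℝ) :
    magnetization n ((hartley n).mulVec y) = Real.sqrt n * y ⟨0, hn⟩ := by
  have h1 : ∀ i, (1 : ℝ) = Real.sqrt n * hartley n ⟨0, hn⟩ i := by
    intro i
    have : Real.sqrt n ≠ 0 := by
      rw [Real.sqrt_ne_zero']; exact_mod_cast hn
    simp [hartley, cas, this]
  have h2 : (hartley n).mulVec ((hartley n).mulVec y) ⟨0, hn⟩ = y ⟨0, hn⟩ := by
    rw [Matrix.mulVec_mulVec, hartley_mul_self hn, Matrix.one_mulVec]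
  unfold magnetization
  rw [← h2]
  conv_rhs => rw [Matrix.mulVec, dotProduct, Finset.mul_sum]
  refine Finset.sum_congr rfl fun i _ => ?_
  rw [← mul_assoc, ← h1, one_mul]

lemma sum_range_shift_of_periodic {n : ℕ} (g : ℤ → ℝ) (hg : ∀ m, g (m + n) = g m) (j : ℕ) :
    ∑ i ∈ Finset.range n, g (i + j) = ∑ i ∈ Finset.range n, g i := by
  induction j with
  | zero => simp
  | succ j ih =>
    rw [← ih]
    have h1 := Finset.sum_range_succ (fun i : ℕ => g (i + j)) n
    rw [Finset.sum_range_succ'] at h1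
    have h2 : g ((n : ℕ) + j) = g ((0 : ℕ) + j) := by
      rw [add_comm]; simpa using hg j
    rw [h2] at h1
    have h3 := add_right_cancel h1
    rw [← h3]
    refine Finset.sum_congr rfl fun i _ => ?_
    congr 1
    push_cast
    ring

/-- The `n`-periodic extension to `ℤ` of the vector `hartley n *ᵥ y`. -/
def hartleyExtension (n : ℕ) (y : Fin n → ℝ) (m : ℤ) : ℝ :=
  ∑ l : Fin n, cas (2 * Real.pi * m * (l : ℕ) / n) / Real.sqrt n * y l

lemma hartleyExtension_add_period {n : ℕ} (hn : 0 < n) (y : Fin n → ℝ) (m k : ℤ) :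
    hartleyExtension n y (m + k * n) = hartleyExtension n y m := by
  have hn' : (n : ℝ) ≠ 0 := by exact_mod_cast hn.ne'
  unfold hartleyExtension
  refine Finset.sum_congr rfl fun l _ => ?_
  rw [← cas_add_int_mul_two_pi (2 * Real.pi * m * (l : ℕ) / n) (k * l)]
  congr 3
  push_cast
  field_simp

lemma hartleyExtension_natCast (n : ℕ) (y : Fin n → ℝ) (i : Fin n) :
    hartleyExtension n y (i : ℕ) = (hartley n).mulVec y i := by
  simp [hartleyExtension, hartley, Matrix.mulVec, dotProduct]

lemma hartleyExtension_add_add_sub (n : ℕ) (y : Fin n → ℝ) (m j : ℤ) :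
    hartleyExtension n y (m + j) + hartleyExtension n y (m - j) =
      hartleyExtension n (fun l => 2 * Real.cos (2 * Real.pi * j * (l : ℕ) / n) * y l) m := by
  unfold hartleyExtension
  rw [← Finset.sum_add_distrib]
  refine Finset.sum_congr rfl fun l _ => ?_
  have h := cas_add_add_cas_sub (2 * Real.pi * m * (l : ℕ) / n) (2 * Real.pi * j * (l : ℕ) / n)
  have h1 : 2 * Real.pi * ((m + j : ℤ) : ℝ) * (l : ℕ) / n
      = 2 * Real.pi * m * (l : ℕ) / n + 2 * Real.pi * j * (l : ℕ) / n := by push_cast; ring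
  have h2 : 2 * Real.pi * ((m - j : ℤ) : ℝ) * (l : ℕ) / n
      = 2 * Real.pi * m * (l : ℕ) / n - 2 * Real.pi * j * (l : ℕ) / n := by push_cast; ring
  rw [h1, h2, ← add_mul, ← add_div, h]
  ring

/-- Correlations at distance `j` are diagonal in the Hartley basis. Summing over the shifts by
`j` and by `-j` leaves only the eigenvalue `cos (2π j k / n)`. -/
lemma sum_correlation_hartley_mulVec {n : ℕ} (hn : 0 < n) (y : Fin n → ℝ) (j : ℕ) :
    ∑ i : Fin n, (hartley n).mulVec y i *
        (hartley n).mulVec y ⟨((i : ℕ) + j) % n, Nat.mod_lt _ hn⟩ =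
      ∑ k : Fin n, Real.cos (2 * Real.pi * j * (k : ℕ) / n) * y k ^ 2 := by
  set X := hartleyExtension n y with hX
  have hper : ∀ m, X (m + n) = X m := fun m => by
    simpa using hartleyExtension_add_period hn y m 1
  have h1 : ∀ i : Fin n, (hartley n).mulVec y i *
      (hartley n).mulVec y ⟨((i : ℕ) + j) % n, Nat.mod_lt _ hn⟩ =
      X ((i : ℕ) : ℤ) * X ((i : ℕ) + j) := by
    intro i
    rw [← hartleyExtension_natCast, ← hartleyExtension_natCast]
    congr 1
    simp only
    rw [← hartleyExtension_add_period hn y _ ((((i : ℕ) + j) / n : ℕ) : ℤ)]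
    congr 1
    have := Nat.mod_add_div' ((i : ℕ) + j) n
    exact_mod_cast this
  have h2 : ∑ i : Fin n, X ((i : ℕ) : ℤ) * X ((i : ℕ) - j) =
      ∑ i : Fin n, X ((i : ℕ) : ℤ) * X ((i : ℕ) + j) := by
    rw [Fin.sum_univ_eq_sum_range (fun i : ℕ => X (i : ℤ) * X (i - j)),
      Fin.sum_univ_eq_sum_range (fun i : ℕ => X (i : ℤ) * X (i + j)),
      ← sum_range_shift_of_periodic (fun m : ℤ => X m * X (m - j)) _ j]
    · refine Finset.sum_congr rfl fun i _ => ?_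
      rw [add_sub_cancel_right, mul_comm]
    · intro m
      rw [hper, add_sub_right_comm, hper]
  have h3 : 2 * ∑ i : Fin n, X ((i : ℕ) : ℤ) * X ((i : ℕ) + j) =
      ((hartley n).mulVec y) ⬝ᵥ ((hartley n).mulVec
        (fun l : Fin n => 2 * Real.cos (2 * Real.pi * (j : ℤ) * (l : ℕ) / n) * y l)) := by
    rw [two_mul]
    nth_rw 2 [← h2]
    rw [← Finset.sum_add_distrib, dotProduct]
    refine Finset.sum_congr rfl fun i _ => ?_
    rw [← mul_add, hX, hartleyExtension_add_add_sub, hartleyExtension_natCast,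
      hartleyExtension_natCast]
  rw [Matrix.dotProduct_mulVec, ← Matrix.mulVec_transpose, hartley_transpose,
      Matrix.mulVec_mulVec, hartley_mul_self hn, Matrix.one_mulVec, dotProduct] at h3
  rw [Finset.sum_congr rfl fun i _ => h1 i]
  have h4 : ∑ i : Fin n, y i * (2 * Real.cos (2 * Real.pi * (j : ℤ) * (i : ℕ) / n) * y i) =
      2 * ∑ k : Fin n, Real.cos (2 * Real.pi * j * (k : ℕ) / n) * y k ^ 2 := by
    rw [Finset.mul_sum]
    refine Finset.sum_congr rfl fun i _ => ?_
    push_cast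
    ring
  linarith

/-- The symbol `a(t) = (1/r) ∑_{m=1}^r cos (2π m t)` of the interaction. -/
def symbol (r : ℕ) (t : ℝ) : ℝ :=
  1 / (r : ℝ) * ∑ m ∈ Finset.Icc 1 r, Real.cos (2 * Real.pi * m * t)

lemma hamiltonian_hartley_mulVec {n : ℕ} (hn : 0 < n) (r : ℕ) (y : Fin n → ℝ) :
    hamiltonian r n ((hartley n).mulVec y) =
      -(1 / 2) * ∑ k : Fin n, symbol r ((k : ℕ) / n) * y k ^ 2 := by
  unfold hamiltonian
  rw [Finset.sum_comm, Finset.sum_congr rfl fun j _ => sum_correlation_hartley_mulVec hn y j,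
    Finset.sum_comm]
  simp only [← Finset.sum_mul, symbol, Finset.mul_sum]
  refine Finset.sum_congr rfl fun k _ => ?_
  simp only [Finset.sum_mul, Finset.mul_sum]
  refine Finset.sum_congr rfl fun m _ => ?_
  rw [mul_div_assoc]
  ring

/-! ### Gaussian density and radial rescaling -/

/-- The density of `gaussianProduct n` with respect to Lebesgue measure. -/
def gaussianDensity (n : ℕ) (x : Fin n → ℝ) : ℝ :=
  (Real.sqrt (2 * Real.pi))⁻¹ ^ n * Real.exp (-(∑ i, x i ^ 2) / 2)

lemma gaussianDensity_nonneg (n : ℕ) (x : Fin n → ℝ) : 0 ≤ gaussianDensity n x := by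
  unfold gaussianDensity; positivity

lemma measurable_gaussianDensity (n : ℕ) : Measurable (gaussianDensity n) := by
  unfold gaussianDensity; fun_prop

lemma gaussianDensity_eq_prod (n : ℕ) (x : Fin n → ℝ) :
    gaussianDensity n x = ∏ i, gaussianPDFReal 0 1 (x i) := by
  simp only [gaussianPDFReal, gaussianDensity, Finset.prod_mul_distrib, ← Real.exp_sum]
  simp [Finset.sum_div, neg_div]

lemma gaussianProduct_eq_withDensity (n : ℕ) :
    gaussianProduct n =
      (volume : Measure (Fin n → ℝ)).withDensity fun x => ENNReal.ofReal (gaussianDensity n x) := by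
  unfold gaussianProduct
  refine Measure.pi_eq fun s hs => ?_
  rw [withDensity_apply _ (MeasurableSet.univ_pi hs)]
  have hint : ∀ i, Integrable ((s i).indicator (gaussianPDFReal 0 1)) := fun i =>
    (integrable_gaussianPDFReal 0 1).indicator (hs i)
  have h1 : ∀ i, gaussianReal 0 1 (s i)
      = ENNReal.ofReal (∫ x, (s i).indicator (gaussianPDFReal 0 1) x) := by
    intro i
    rw [gaussianReal_apply_eq_integral _ one_ne_zero, integral_indicator (hs i)]
  have hnn : ∀ i x, 0 ≤ (s i).indicator (gaussianPDFReal 0 1) x := fun i x =>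
    Set.indicator_nonneg (fun x _ => gaussianPDFReal_nonneg 0 1 x) x
  rw [Finset.prod_congr rfl fun i _ => h1 i,
    ← ENNReal.ofReal_prod_of_nonneg fun i _ => integral_nonneg (hnn i),
    ← integral_fintype_prod_eq_prod, ofReal_integral_eq_lintegral_ofReal
      (Integrable.fintype_prod hint) (ae_of_all _ fun x => Finset.prod_nonneg fun i _ => hnn i _),
    ← lintegral_indicator (MeasurableSet.univ_pi hs)]
  rw [← volume_pi]
  refine lintegral_congr fun x => ?_
  by_cases hx : x ∈ Set.univ.pi s
  · rw [Set.indicator_of_mem hx, gaussianDensity_eq_prod]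
    congr 1
    refine Finset.prod_congr rfl fun i _ => ?_
    rw [Set.indicator_of_mem (hx i (Set.mem_univ i))]
  · rw [Set.indicator_of_notMem hx]
    simp only [Set.mem_pi, Set.mem_univ, true_implies, not_forall] at hx
    obtain ⟨i, hi⟩ := hx
    rw [Finset.prod_eq_zero (Finset.mem_univ i) (Set.indicator_of_notMem hi _), ENNReal.ofReal_zero]

lemma lintegral_gaussianProduct (n : ℕ) {F : (Fin n → ℝ) → ℝ≥0∞} (hF : Measurable F) :
    ∫⁻ x, F x ∂(gaussianProduct n) = ∫⁻ x, ENNReal.ofReal (gaussianDensity n x) * F x := by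
  rw [gaussianProduct_eq_withDensity,
    lintegral_withDensity_eq_lintegral_mul _ (measurable_gaussianDensity n).ennreal_ofReal hF]
  rfl

lemma lintegral_comp_mulVec {n : ℕ} {M : Matrix (Fin n) (Fin n) ℝ} (hM : M.det ≠ 0)
    {F : (Fin n → ℝ) → ℝ≥0∞} (hF : Measurable F) :
    ∫⁻ y, F (M.mulVec y) = ENNReal.ofReal |M.det⁻¹| * ∫⁻ x, F x := by
  have h := Real.map_matrix_volume_pi_eq_smul_volume_pi hM
  have hm : Measurable (Matrix.toLin' M) := (LinearMap.continuous_of_finiteDimensional _).measurable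
  rw [← smul_eq_mul, ← lintegral_smul_measure, ← h, lintegral_map hF hm]
  rfl

/-- Integration in polar coordinates. -/
lemma lintegral_eq_lintegral_sphere {n : ℕ} [NeZero n] {F : (Fin n → ℝ) → ℝ≥0∞}
    (hF : Measurable F) :
    ∫⁻ x, F x = ∫⁻ u : Metric.sphere (0 : Fin n → ℝ) 1,
      (∫⁻ t in Set.Ioi (0 : ℝ), ENNReal.ofReal (t ^ (n - 1)) * F (t • (u : Fin n → ℝ)))
      ∂(volume : Measure (Fin n → ℝ)).toSphere := by
  have hmp := (volume : Measure (Fin n → ℝ)).measurePreserving_homeomorphUnitSphereProd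
  have h0 : ∫⁻ x, F x = ∫⁻ x : ({0}ᶜ : Set (Fin n → ℝ)), F (x : Fin n → ℝ)
      ∂(Measure.comap (Subtype.val : ({0}ᶜ : Set (Fin n → ℝ)) → Fin n → ℝ) volume) := by
    rw [lintegral_subtype_comap (measurableSet_singleton _).compl, restrict_compl_singleton]
  have h1 : ∀ x : ({0}ᶜ : Set (Fin n → ℝ)), F x =
      (fun p : Metric.sphere (0 : Fin n → ℝ) 1 × Set.Ioi (0 : ℝ) =>
        F ((p.2 : ℝ) • (p.1 : Fin n → ℝ))) (homeomorphUnitSphereProd _ x) := by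
    intro x
    have hx : ‖(x : Fin n → ℝ)‖ ≠ 0 := norm_ne_zero_iff.2 x.2
    simp [smul_smul, hx]
  have hFm : Measurable (fun p : Metric.sphere (0 : Fin n → ℝ) 1 × Set.Ioi (0 : ℝ) =>
        F ((p.2 : ℝ) • (p.1 : Fin n → ℝ))) := by
    refine hF.comp ?_
    fun_prop
  rw [h0, lintegral_congr h1, hmp.lintegral_comp hFm, lintegral_prod _ hFm.aemeasurable]
  refine lintegral_congr fun u => ?_
  have hm : Measurable fun t : ℝ => F (t • (u : Fin n → ℝ)) := hF.comp (by fun_prop)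
  have hm' : Measurable fun t : Set.Ioi (0 : ℝ) => F ((t : ℝ) • (u : Fin n → ℝ)) :=
    hm.comp measurable_subtype_coe
  rw [Measure.volumeIoiPow]
  dsimp only
  rw [lintegral_withDensity_eq_lintegral_mul _ (by fun_prop) hm']
  simp only [Module.finrank_fintype_fun_eq_card, Fintype.card_fin]
  exact lintegral_subtype_comap measurableSet_Ioi
    (fun t : ℝ => ENNReal.ofReal (t ^ (n - 1)) * F (t • (u : Fin n → ℝ)))

lemma lintegral_Ioi_comp_mul_left {F : ℝ → ℝ≥0∞} (hF : Measurable F) {a : ℝ} (ha : 0 < a) :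
    ∫⁻ t in Set.Ioi (0 : ℝ), ENNReal.ofReal a * F (a * t) = ∫⁻ t in Set.Ioi (0 : ℝ), F t := by
  have hind : ∀ t, (Set.Ioi (0 : ℝ)).indicator (fun t => F (a * t)) t =
      (Set.Ioi (0 : ℝ)).indicator F (a * t) := by
    intro t
    simp only [Set.indicator, Set.mem_Ioi, mul_pos_iff_of_pos_left ha]
  rw [lintegral_const_mul _ (by fun_prop), ← lintegral_indicator measurableSet_Ioi,
    lintegral_congr hind, ← lintegral_map (hF.indicator measurableSet_Ioi) (by fun_prop),
    Real.map_volume_mul_left ha.ne', lintegral_smul_measure, smul_eq_mul, ← mul_assoc,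
    ← ENNReal.ofReal_mul ha.le, abs_of_pos (inv_pos.2 ha), mul_inv_cancel₀ ha.ne',
    ENNReal.ofReal_one, one_mul, lintegral_indicator measurableSet_Ioi]

/-- Rescaling every ray by a factor `ρ` which only depends on the direction: the map
`x ↦ ρ(x) x` has Jacobian `ρ ^ n`. -/
lemma lintegral_radial_rescale {n : ℕ} [NeZero n] {ρ : (Fin n → ℝ) → ℝ} (hρm : Measurable ρ)
    (hρ : ∀ x, x ≠ 0 → 0 < ρ x) (hhom : ∀ t : ℝ, 0 < t → ∀ x, ρ (t • x) = ρ x)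
    {F : (Fin n → ℝ) → ℝ≥0∞} (hF : Measurable F) :
    ∫⁻ x, ENNReal.ofReal (ρ x ^ n) * F (ρ x • x) = ∫⁻ x, F x := by
  have hm : Measurable fun x : Fin n → ℝ => ENNReal.ofReal (ρ x ^ n) * F (ρ x • x) :=
    (hρm.pow_const n).ennreal_ofReal.mul (hF.comp (hρm.smul measurable_id))
  rw [lintegral_eq_lintegral_sphere hm, lintegral_eq_lintegral_sphere hF]
  refine lintegral_congr fun u => ?_
  have hu : (u : Fin n → ℝ) ≠ 0 := by
    intro h
    have := u.2
    simp [h] at this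
  have hpos := hρ _ hu
  set a := ρ (u : Fin n → ℝ) with ha
  have hm2 : Measurable fun t : ℝ => ENNReal.ofReal (t ^ (n - 1)) * F (t • (u : Fin n → ℝ)) :=
    (by fun_prop : Measurable fun t : ℝ => ENNReal.ofReal (t ^ (n - 1))).mul
      (hF.comp (by fun_prop))
  rw [← lintegral_Ioi_comp_mul_left hm2 hpos]
  refine setLIntegral_congr_fun measurableSet_Ioi fun t ht => ?_
  have ht' : (0 : ℝ) < t := ht
  rw [hhom t ht', ← ha, smul_smul, ← mul_assoc, ← mul_assoc, ← ENNReal.ofReal_mul (by positivity),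
    ← ENNReal.ofReal_mul (by positivity)]
  congr 2
  have hn : n = (n - 1) + 1 := (Nat.succ_pred_eq_of_ne_zero (NeZero.ne n)).symm
  rw [mul_pow]
  conv_lhs => rw [hn, pow_succ]
  simp only [Nat.add_sub_cancel]
  ring

/-! ### Reduction to a tilted standard Gaussian vector -/

/-- The ratio `∑ z_k² / ∑ b_k z_k²`, which fluctuates around `1` when the `b_k` have mean `1`. -/
def energyRatio {n : ℕ} (b : Fin n → ℝ) (z : Fin n → ℝ) : ℝ :=
  (∑ k, z k ^ 2) / ∑ k, b k * z k ^ 2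

/-- The weight `exp ((n / 2) (log w - w + 1))`, where `w` is the energy ratio. It never exceeds `1`
because `log w ≤ w - 1`. -/
def tiltWeight {n : ℕ} (b : Fin n → ℝ) (z : Fin n → ℝ) : ℝ :=
  Real.exp ((n : ℝ) / 2 * (Real.log (energyRatio b z) - energyRatio b z + 1))

lemma measurable_energyRatio {n : ℕ} (b : Fin n → ℝ) : Measurable (energyRatio b) := by
  unfold energyRatio; fun_prop

lemma measurable_tiltWeight {n : ℕ} (b : Fin n → ℝ) : Measurable (tiltWeight b) := by
  have := measurable_energyRatio b
  unfold tiltWeight; fun_prop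

lemma symbol_le_one (r : ℕ) (t : ℝ) : symbol r t ≤ 1 := by
  unfold symbol
  have h : ∑ m ∈ Finset.Icc 1 r, Real.cos (2 * Real.pi * m * t) ≤ r := by
    refine (Finset.sum_le_sum fun m _ => Real.cos_le_one _).trans ?_
    simp
  rw [one_div, inv_mul_eq_div]
  exact div_le_one_of_le₀ h (by positivity)

lemma neg_one_le_symbol (r : ℕ) (t : ℝ) : -1 ≤ symbol r t := by
  unfold symbol
  have h : -(r : ℝ) ≤ ∑ m ∈ Finset.Icc 1 r, Real.cos (2 * Real.pi * m * t) := by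
    refine le_trans ?_ (Finset.sum_le_sum fun m _ => Real.neg_one_le_cos _)
    simp
  rcases Nat.eq_zero_or_pos r with rfl | hr
  · simp
  · have hr' : (0 : ℝ) < r := by exact_mod_cast hr
    rw [one_div, inv_mul_eq_div, le_div_iff₀ hr']
    linarith

lemma sum_sq_pos {n : ℕ} {x : Fin n → ℝ} (hx : x ≠ 0) : 0 < ∑ i, x i ^ 2 := by
  obtain ⟨i, hi⟩ := Function.ne_iff.1 hx
  have : 0 < x i ^ 2 := by
    have : x i ≠ 0 := hi
    positivity
  exact this.trans_le (Finset.single_le_sum (f := fun i => x i ^ 2) (fun i _ => sq_nonneg _)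
      (Finset.mem_univ i))

lemma sum_mul_sq_pos {n : ℕ} {b x : Fin n → ℝ} (hb : ∀ k, 0 < b k) (hx : x ≠ 0) :
    0 < ∑ i, b i * x i ^ 2 := by
  have h := sum_sq_pos (x := fun i => Real.sqrt (b i) * x i) (by
    obtain ⟨i, hi⟩ := Function.ne_iff.1 hx
    exact Function.ne_iff.2 ⟨i, mul_ne_zero (Real.sqrt_ne_zero'.2 (hb i)) hi⟩)
  simpa only [mul_pow, Real.sq_sqrt (hb _).le] using h

lemma hamiltonian_smul (r n : ℕ) (t : ℝ) (x : Fin n → ℝ) :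
    hamiltonian r n (t • x) = t ^ 2 * hamiltonian r n x := by
  unfold hamiltonian
  simp only [Pi.smul_apply, smul_eq_mul, Finset.mul_sum]
  refine Finset.sum_congr rfl fun i _ => Finset.sum_congr rfl fun j _ => ?_
  ring

lemma sum_sq_smul (n : ℕ) (t : ℝ) (x : Fin n → ℝ) :
    ∑ i, (t • x) i ^ 2 = t ^ 2 * ∑ i, x i ^ 2 := by
  simp only [Pi.smul_apply, smul_eq_mul, Finset.mul_sum, mul_pow]

lemma neg_hamiltonian_le_half_sum_sq {n : ℕ} (hn : 0 < n) (r : ℕ) (x : Fin n → ℝ) :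
    -hamiltonian r n x ≤ (1 / 2) * ∑ i, x i ^ 2 := by
  have hx : (hartley n).mulVec ((hartley n).mulVec x) = x := by
    rw [Matrix.mulVec_mulVec, hartley_mul_self hn, Matrix.one_mulVec]
  rw [← hx, hamiltonian_hartley_mulVec hn, sum_sq_hartley_mulVec hn]
  have : ∑ k : Fin n, symbol r ((k : ℕ) / n) * (hartley n).mulVec x k ^ 2 ≤
      ∑ k : Fin n, (hartley n).mulVec x k ^ 2 :=
    Finset.sum_le_sum fun k _ => by
      nlinarith [symbol_le_one r ((k : ℕ) / n), sq_nonneg ((hartley n).mulVec x k)]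
  linarith

lemma measurable_hamiltonian (r n : ℕ) : Measurable (hamiltonian r n) := by
  unfold hamiltonian; fun_prop

/-- The variance `1 / (s - a(k / n))` of the `k`-th Hartley coordinate under the Gaussian law whose
quadratic form is `s |x|² + 2 H_n(x)`. -/
def modeVariance (r n : ℕ) (s : ℝ) (k : Fin n) : ℝ :=
  (s - symbol r ((k : ℕ) / n))⁻¹

lemma modeVariance_pos (r n : ℕ) {s : ℝ} (hs : 1 < s) (k : Fin n) : 0 < modeVariance r n s k :=
  inv_pos.2 (by linarith [symbol_le_one r ((k : ℕ) / n)])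

/-- The quadratic form `s |x|² + 2 H_n(x)` divided by `|x|²`. -/
def formRatio (r n : ℕ) (s : ℝ) (x : Fin n → ℝ) : ℝ :=
  s + 2 * hamiltonian r n x / ∑ i, x i ^ 2

lemma measurable_formRatio (r n : ℕ) (s : ℝ) : Measurable (formRatio r n s) := by
  have := measurable_hamiltonian r n
  unfold formRatio; fun_prop

lemma formRatio_smul (r n : ℕ) (s : ℝ) {t : ℝ} (ht : t ≠ 0) (x : Fin n → ℝ) :
    formRatio r n s (t • x) = formRatio r n s x := by
  unfold formRatio
  rw [hamiltonian_smul, sum_sq_smul, mul_left_comm, mul_div_mul_left _ _ (pow_ne_zero 2 ht)]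

lemma formRatio_pos {n : ℕ} (hn : 0 < n) (r : ℕ) {s : ℝ} (hs : 1 < s) {x : Fin n → ℝ}
    (hx : x ≠ 0) : 0 < formRatio r n s x := by
  have h1 := neg_hamiltonian_le_half_sum_sq hn r x
  have h2 := sum_sq_pos hx
  have h3 : -1 ≤ 2 * hamiltonian r n x / ∑ i, x i ^ 2 := by
    rw [le_div_iff₀ h2]; linarith
  unfold formRatio
  linarith

/-- The linear map which turns a standard Gaussian vector into a Gaussian vector with quadratic form
`s |x|² + 2 H_n(x)`. -/
def modeMatrix (r n : ℕ) (s : ℝ) : Matrix (Fin n) (Fin n) ℝ :=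
  hartley n * Matrix.diagonal fun k => Real.sqrt (modeVariance r n s k)

lemma det_modeMatrix_ne_zero {n : ℕ} (hn : 0 < n) (r : ℕ) {s : ℝ} (hs : 1 < s) :
    (modeMatrix r n s).det ≠ 0 := by
  unfold modeMatrix
  rw [Matrix.det_mul, Matrix.det_diagonal]
  exact mul_ne_zero (det_hartley_ne_zero hn)
    (Finset.prod_ne_zero_iff.2 fun k _ => Real.sqrt_ne_zero'.2 (modeVariance_pos r n hs k))

lemma modeMatrix_mulVec (r n : ℕ) (s : ℝ) (z : Fin n → ℝ) :
    (modeMatrix r n s).mulVec z =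
      (hartley n).mulVec fun k => Real.sqrt (modeVariance r n s k) * z k := by
  unfold modeMatrix
  rw [← Matrix.mulVec_mulVec]
  congr 1
  ext k
  rw [Matrix.mulVec_diagonal]

lemma sum_sq_modeMatrix {n : ℕ} (hn : 0 < n) (r : ℕ) {s : ℝ} (hs : 1 < s) (z : Fin n → ℝ) :
    ∑ i, ((modeMatrix r n s).mulVec z i) ^ 2 = ∑ k, modeVariance r n s k * z k ^ 2 := by
  rw [modeMatrix_mulVec, sum_sq_hartley_mulVec hn]
  simp only [mul_pow, Real.sq_sqrt (modeVariance_pos r n hs _).le]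

lemma two_mul_hamiltonian_modeMatrix {n : ℕ} (hn : 0 < n) (r : ℕ) {s : ℝ} (hs : 1 < s)
    (z : Fin n → ℝ) :
    2 * hamiltonian r n ((modeMatrix r n s).mulVec z) =
      ∑ k, z k ^ 2 - s * ∑ k, modeVariance r n s k * z k ^ 2 := by
  rw [modeMatrix_mulVec, hamiltonian_hartley_mulVec hn, Finset.mul_sum (a := s),
    ← Finset.sum_sub_distrib, ← mul_assoc, Finset.mul_sum]
  refine Finset.sum_congr rfl fun k _ => ?_
  have h1 := modeVariance_pos r n hs k
  have h2 : modeVariance r n s k * (s - symbol r ((k : ℕ) / n)) = 1 :=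
    inv_mul_cancel₀ (by linarith [symbol_le_one r ((k : ℕ) / n)])
  rw [mul_pow, Real.sq_sqrt h1.le]
  linear_combination z k ^ 2 * h2

lemma formRatio_modeMatrix {n : ℕ} (hn : 0 < n) (r : ℕ) {s : ℝ} (hs : 1 < s)
    {z : Fin n → ℝ} (hz : z ≠ 0) :
    formRatio r n s ((modeMatrix r n s).mulVec z) = energyRatio (modeVariance r n s) z := by
  have h := sum_mul_sq_pos (modeVariance_pos r n hs) hz
  unfold formRatio energyRatio
  rw [two_mul_hamiltonian_modeMatrix hn r hs, sum_sq_modeMatrix hn r hs]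
  field_simp
  ring

lemma magnetization_smul (n : ℕ) (t : ℝ) (x : Fin n → ℝ) :
    magnetization n (t • x) = t * magnetization n x := by
  simp [magnetization, Finset.mul_sum]

lemma weight_smul_of_pos (r n : ℕ) {t : ℝ} (ht : 0 < t) (x : Fin n → ℝ) :
    weight r n (t • x) = weight r n x := by
  have h1 : temperature n (t • x) = t ^ 2 * temperature n x := by
    unfold temperature; rw [sum_sq_smul, mul_div_assoc]
  have ht2 : 0 < t ^ 2 := by positivity
  unfold weight
  simp only [Set.indicator, Set.mem_ofPred_eq, h1, mul_pos_iff_of_pos_left ht2, hamiltonian_smul,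
    ← mul_neg, mul_div_mul_left _ _ ht2.ne']

lemma weight_eq_exp_formRatio {n : ℕ} (hn : 0 < n) (r : ℕ) (s : ℝ) {x : Fin n → ℝ} (hx : x ≠ 0) :
    weight r n x = Real.exp ((n : ℝ) / 2 * (s - formRatio r n s x)) := by
  have h := sum_sq_pos hx
  have hn' : (0 : ℝ) < n := by exact_mod_cast hn
  have hT : 0 < temperature n x := div_pos h hn'
  unfold weight
  rw [Set.indicator_of_mem (show x ∈ {x | 0 < temperature n x} from hT)]
  congr 1
  unfold formRatio temperature
  field_simp
  ring

/-- The density of the model after rescaling each ray by `√w` and diagonalizing. The radial part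
becomes exactly Gaussian, and what remains of the weight is the tilt. -/
lemma density_transform {n : ℕ} (hn : 0 < n) (r : ℕ) {s : ℝ} (hs : 1 < s)
    {z : Fin n → ℝ} (hz : z ≠ 0) :
    let x := (modeMatrix r n s).mulVec z
    Real.sqrt (formRatio r n s x) ^ n * gaussianDensity n (Real.sqrt (formRatio r n s x) • x) *
        weight r n (Real.sqrt (formRatio r n s x) • x) =
      Real.exp ((n : ℝ) / 2 * (s - 1)) * (gaussianDensity n z *
        tiltWeight (modeVariance r n s) z) := by
  intro x
  have hd := sum_mul_sq_pos (modeVariance_pos r n hs) hz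
  have hq := sum_sq_pos hz
  have hx : x ≠ 0 := by
    intro h
    have := sum_sq_modeMatrix hn r hs z
    rw [← this] at hd
    change 0 < ∑ i, x i ^ 2 at hd
    simp [h] at hd
  have hw := formRatio_pos hn r hs hx
  have hsq : 0 < Real.sqrt (formRatio r n s x) := Real.sqrt_pos.2 hw
  rw [weight_smul_of_pos r n hsq, weight_eq_exp_formRatio hn r s hx]
  unfold gaussianDensity
  rw [sum_sq_smul, Real.sq_sqrt hw.le, sum_sq_modeMatrix hn r hs,
    formRatio_modeMatrix hn r hs hz]
  rw [formRatio_modeMatrix hn r hs hz] at hw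
  unfold tiltWeight
  have h1 : energyRatio (modeVariance r n s) z * ∑ k, modeVariance r n s k * z k ^ 2
      = ∑ k, z k ^ 2 := div_mul_cancel₀ _ hd.ne'
  have h2 : Real.sqrt (energyRatio (modeVariance r n s) z) ^ n =
      Real.exp ((n : ℝ) / 2 * Real.log (energyRatio (modeVariance r n s) z)) := by
    rw [← Real.exp_log (pow_pos (Real.sqrt_pos.2 hw) n), Real.log_pow, Real.log_sqrt hw.le]
    congr 1
    ring
  rw [h1, h2]
  set W := energyRatio (modeVariance r n s) z
  calc _ = (Real.sqrt (2 * Real.pi))⁻¹ ^ n * (Real.exp ((n : ℝ) / 2 * Real.log W) *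
        Real.exp (-(∑ k, z k ^ 2) / 2) * Real.exp ((n : ℝ) / 2 * (s - W))) := by ring
    _ = (Real.sqrt (2 * Real.pi))⁻¹ ^ n * (Real.exp ((n : ℝ) / 2 * (s - 1)) *
        Real.exp (-(∑ k, z k ^ 2) / 2) * Real.exp ((n : ℝ) / 2 * (Real.log W - W + 1))) := by
      simp only [← Real.exp_add]
      congr 2
      ring
    _ = _ := by ring

lemma ae_volume_ne_zero {n : ℕ} (hn : 0 < n) : ∀ᵐ x : Fin n → ℝ, x ≠ 0 := by
  have : Nonempty (Fin n) := ⟨⟨0, hn⟩⟩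
  simp [ae_iff]

/-- Under the unnormalized law of the spins, `S_n / √n` is distributed, up to a constant factor,
like `√w √b_0 z_0` under the tilted law of a standard Gaussian vector `z`. -/
lemma exists_lintegral_weight_eq {n : ℕ} (hn : 0 < n) (r : ℕ) {s : ℝ} (hs : 1 < s) :
    ∃ C : ℝ≥0∞, ∀ f : ℝ → ℝ≥0∞, Measurable f →
      ∫⁻ x, f (magnetization n x / Real.sqrt n) * ENNReal.ofReal (weight r n x)
          ∂(gaussianProduct n) =
        C * ∫⁻ z, f (Real.sqrt (energyRatio (modeVariance r n s) z) *
            (Real.sqrt (modeVariance r n s ⟨0, hn⟩) * z ⟨0, hn⟩)) *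
          ENNReal.ofReal (tiltWeight (modeVariance r n s) z) ∂(gaussianProduct n) := by
  have : NeZero n := ⟨hn.ne'⟩
  have hdet := det_modeMatrix_ne_zero hn r hs
  set M := modeMatrix r n s with hM
  set b := modeVariance r n s with hb
  set ρ : (Fin n → ℝ) → ℝ := fun x => Real.sqrt (formRatio r n s x) with hρ
  have hρm : Measurable ρ := (measurable_formRatio r n s).sqrt
  refine ⟨ENNReal.ofReal |M.det| * ENNReal.ofReal (Real.exp ((n : ℝ) / 2 * (s - 1))),
    fun f hf => ?_⟩
  have hwm := measurable_weight r n
  have hgm := measurable_gaussianDensity n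
  have htm := measurable_tiltWeight b
  have hem := measurable_energyRatio b
  have hSm : Measurable (magnetization n) := by unfold magnetization; fun_prop
  have hm1 : Measurable fun x => f (magnetization n x / Real.sqrt n) *
      ENNReal.ofReal (weight r n x) := by fun_prop
  have hm2 : Measurable fun z : Fin n → ℝ => f (Real.sqrt (energyRatio b z) *
      (Real.sqrt (b ⟨0, hn⟩) * z ⟨0, hn⟩)) * ENNReal.ofReal (tiltWeight b z) := by fun_prop
  rw [lintegral_gaussianProduct n hm1, lintegral_gaussianProduct n hm2]
  have hm3 : Measurable fun x => ENNReal.ofReal (gaussianDensity n x) *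
      (f (magnetization n x / Real.sqrt n) * ENNReal.ofReal (weight r n x)) := by fun_prop
  rw [← lintegral_radial_rescale hρm
    (fun x hx => Real.sqrt_pos.2 (formRatio_pos hn r hs hx))
    (fun t ht x => by simp only [hρ, formRatio_smul r n s ht.ne']) hm3]
  have hm4 : Measurable fun x => ENNReal.ofReal (ρ x ^ n) *
      (ENNReal.ofReal (gaussianDensity n (ρ x • x)) *
      (f (magnetization n (ρ x • x) / Real.sqrt n) * ENNReal.ofReal (weight r n (ρ x • x)))) :=
    (hρm.pow_const n).ennreal_ofReal.mul (hm3.comp (hρm.smul measurable_id))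
  have hcv := lintegral_comp_mulVec hdet hm4
  have hone : ENNReal.ofReal |M.det| * ENNReal.ofReal |M.det⁻¹| = 1 := by
    rw [← ENNReal.ofReal_mul (abs_nonneg _), ← abs_mul, mul_inv_cancel₀ hdet, abs_one,
      ENNReal.ofReal_one]
  have hcv' := congrArg (fun t => ENNReal.ofReal |M.det| * t) hcv
  simp only [← mul_assoc, hone, one_mul] at hcv'
  simp only [← mul_assoc]
  rw [← hcv', mul_assoc]
  congr 1
  rw [← lintegral_const_mul _ (by fun_prop)]
  refine lintegral_congr_ae ?_
  filter_upwards [ae_volume_ne_zero hn] with z hz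
  have hdt := density_transform hn r hs hz
  simp only [← hM, ← hb] at hdt
  have hS : magnetization n (ρ (M.mulVec z) • M.mulVec z) / Real.sqrt n =
      Real.sqrt (energyRatio b z) * Real.sqrt (b ⟨0, hn⟩) * z ⟨0, hn⟩ := by
    have hsn : Real.sqrt n ≠ 0 := by rw [Real.sqrt_ne_zero']; exact_mod_cast hn
    simp only [hρ]
    rw [magnetization_smul, hM, formRatio_modeMatrix hn r hs hz, modeMatrix_mulVec,
      magnetization_hartley_mulVec hn, ← hb]
    field_simp
  rw [hS]
  set φ := f (Real.sqrt (energyRatio b z) * Real.sqrt (b ⟨0, hn⟩) * z ⟨0, hn⟩)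
  have h0 : 0 ≤ ρ (M.mulVec z) ^ n := pow_nonneg (Real.sqrt_nonneg _) _
  calc _ = φ * ENNReal.ofReal (ρ (M.mulVec z) ^ n * gaussianDensity n (ρ (M.mulVec z) • M.mulVec z)
        * weight r n (ρ (M.mulVec z) • M.mulVec z)) := by
        rw [ENNReal.ofReal_mul (mul_nonneg h0 (gaussianDensity_nonneg _ _)), ENNReal.ofReal_mul h0]
        ring
    _ = _ := by
        simp only [hρ]
        rw [hdt, ENNReal.ofReal_mul (Real.exp_pos _).le,
          ENNReal.ofReal_mul (gaussianDensity_nonneg _ _)]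
        ring

/-! ### Pointwise estimates of the tilt -/

section Pointwise

variable {n : ℕ} {b z : Fin n → ℝ} {β₁ β₂ : ℝ}

lemma abs_sqrt_sub_one_le {w : ℝ} (hw : 0 ≤ w) : |Real.sqrt w - 1| ≤ |w - 1| := by
  have h1 : w - 1 = (Real.sqrt w - 1) * (Real.sqrt w + 1) := by
    linear_combination -Real.sq_sqrt hw
  rw [h1, abs_mul]
  refine le_mul_of_one_le_right (abs_nonneg _) ?_
  rw [abs_of_pos (by positivity)]
  linarith [Real.sqrt_nonneg w]

lemma abs_exp_sub_exp_le {u v : ℝ} (hu : u ≤ 0) (hv : v ≤ 0) :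
    |Real.exp u - Real.exp v| ≤ |u - v| := by
  wlog h : v ≤ u generalizing u v
  · rw [abs_sub_comm, abs_sub_comm u]
    exact this hv hu (le_of_not_ge h)
  rw [abs_of_nonneg (sub_nonneg.2 (Real.exp_le_exp.2 h)), abs_of_nonneg (sub_nonneg.2 h)]
  have h1 : Real.exp v = Real.exp u * Real.exp (v - u) := by rw [← Real.exp_add]; ring_nf
  have h2 := Real.add_one_le_exp (v - u)
  have h3 : Real.exp u ≤ 1 := Real.exp_le_one_iff.2 hu
  rw [h1]
  nlinarith [Real.exp_pos u]

lemma log_sub_self_sub_le {w w' β : ℝ} (hw : 0 < w) (hw' : 0 < w') (hβ : 1 ≤ β * w') :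
    (Real.log w - w) - (Real.log w' - w') ≤ β * (|w' - 1| * |w - w'|) := by
  have h1 : Real.log w - Real.log w' ≤ w / w' - 1 := by
    rw [← Real.log_div hw.ne' hw'.ne']
    exact Real.log_le_sub_one_of_pos (div_pos hw hw')
  have h2 : w / w' - 1 - (w - w') = -((w' - 1) * (w - w')) / w' := by field_simp; ring
  have h3 : -((w' - 1) * (w - w')) ≤ |w' - 1| * |w - w'| := by
    rw [← abs_mul]; exact neg_le_abs _
  have h4 : -((w' - 1) * (w - w')) / w' ≤ β * (|w' - 1| * |w - w'|) := by
    rw [div_le_iff₀ hw']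
    have : 0 ≤ |w' - 1| * |w - w'| := by positivity
    nlinarith
  linarith

/-- `log w - w + 1` vanishes to second order at `w = 1`, so its increments are quadratically small
near `1`. -/
lemma abs_log_sub_self_sub_le {w w' β : ℝ} (hw : 0 < w) (hw' : 0 < w') (hβ : 1 ≤ β * w)
    (hβ' : 1 ≤ β * w') :
    |(Real.log w - w) - (Real.log w' - w')| ≤ β * ((|w - 1| + |w' - 1|) * |w - w'|) := by
  have hβ0 : 0 ≤ β := by
    by_contra h
    nlinarith
  have h1 := log_sub_self_sub_le hw hw' hβ'
  have h2 := log_sub_self_sub_le hw' hw hβ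
  rw [abs_sub_comm w' w] at h2
  have h3 : 0 ≤ β * (|w - 1| * |w - w'|) := by positivity
  have h4 : 0 ≤ β * (|w' - 1| * |w - w'|) := by positivity
  rw [abs_le]
  constructor <;> nlinarith

lemma neg_sq_le_log_sub_self {w β : ℝ} (hw : 0 < w) (hβ : 1 ≤ β * w) :
    -(β * (w - 1) ^ 2) ≤ Real.log w - w + 1 := by
  have h := log_sub_self_sub_le one_pos hw hβ
  rw [Real.log_one, abs_sub_comm 1 w, ← sq, sq_abs] at h
  linarith

lemma sum_mul_sq_le (hb₂ : ∀ k, b k ≤ β₂) : ∑ k, b k * z k ^ 2 ≤ β₂ * ∑ k, z k ^ 2 := by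
  rw [Finset.mul_sum]
  exact Finset.sum_le_sum fun k _ => mul_le_mul_of_nonneg_right (hb₂ k) (sq_nonneg _)

lemma le_sum_mul_sq (hb₁ : ∀ k, β₁ ≤ b k) : β₁ * ∑ k, z k ^ 2 ≤ ∑ k, b k * z k ^ 2 := by
  rw [Finset.mul_sum]
  exact Finset.sum_le_sum fun k _ => mul_le_mul_of_nonneg_right (hb₁ k) (sq_nonneg _)

lemma energyRatio_pos (hβ₁ : 0 < β₁) (hb₁ : ∀ k, β₁ ≤ b k) (hz : z ≠ 0) :
    0 < energyRatio b z :=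
  div_pos (sum_sq_pos hz) (sum_mul_sq_pos (fun k => hβ₁.trans_le (hb₁ k)) hz)

lemma one_le_mul_energyRatio (hβ₁ : 0 < β₁) (hb₁ : ∀ k, β₁ ≤ b k) (hb₂ : ∀ k, b k ≤ β₂)
    (hz : z ≠ 0) : 1 ≤ β₂ * energyRatio b z := by
  have hd := sum_mul_sq_pos (fun k => hβ₁.trans_le (hb₁ k)) hz
  unfold energyRatio
  rw [← mul_div_assoc, le_div_iff₀ hd, one_mul]
  exact sum_mul_sq_le hb₂

lemma energyRatio_le (hβ₁ : 0 < β₁) (hb₁ : ∀ k, β₁ ≤ b k) (hz : z ≠ 0) :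
    energyRatio b z ≤ 1 / β₁ := by
  have hd := sum_mul_sq_pos (fun k => hβ₁.trans_le (hb₁ k)) hz
  unfold energyRatio
  rw [div_le_div_iff₀ hd hβ₁, one_mul, mul_comm]
  exact le_sum_mul_sq hb₁

lemma tiltWeight_pos : 0 < tiltWeight b z := Real.exp_pos _

lemma tiltExponent_nonpos (hβ₁ : 0 < β₁) (hb₁ : ∀ k, β₁ ≤ b k) (hz : z ≠ 0) :
    (n : ℝ) / 2 * (Real.log (energyRatio b z) - energyRatio b z + 1) ≤ 0 := by
  have h := Real.log_le_sub_one_of_pos (energyRatio_pos hβ₁ hb₁ hz)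
  exact mul_nonpos_of_nonneg_of_nonpos (by positivity) (by linarith)

lemma tiltWeight_le_one (hβ₁ : 0 < β₁) (hb₁ : ∀ k, β₁ ≤ b k) (hz : z ≠ 0) :
    tiltWeight b z ≤ 1 :=
  Real.exp_le_one_iff.2 (tiltExponent_nonpos hβ₁ hb₁ hz)

/-- The deviation of the two quadratic forms `∑ z_k²` and `∑ b_k z_k²` from each other
and from `n`. -/
def energyDeviation (b z : Fin n → ℝ) : ℝ :=
  (∑ k, z k ^ 2 - ∑ k, b k * z k ^ 2) ^ 2 + (∑ k, z k ^ 2 - n) ^ 2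

/-- Where `∑ z_k² < n / 2`, the ratio is merely bounded, but then the second term of the energy
deviation is at least `n² / 4`. -/
lemma sq_energyRatio_sub_one_le (hβ₁ : 0 < β₁) (hb₁ : ∀ k, β₁ ≤ b k) (hn : 0 < n)
    (hz : z ≠ 0) :
    (energyRatio b z - 1) ^ 2 ≤ 4 * (1 + 1 / β₁) ^ 2 * (energyDeviation b z / (n : ℝ) ^ 2) := by
  have hn' : (0 : ℝ) < n := by exact_mod_cast hn
  have hd := sum_mul_sq_pos (fun k => hβ₁.trans_le (hb₁ k)) hz
  have hdq := le_sum_mul_sq (z := z) hb₁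
  have hw0 := energyRatio_pos hβ₁ hb₁ hz
  have hw1 := energyRatio_le hβ₁ hb₁ hz
  rw [← mul_div_assoc, le_div_iff₀ (by positivity)]
  unfold energyDeviation
  have hβ : 0 < 1 / β₁ := by positivity
  rcases le_or_gt ((n : ℝ) / 2) (∑ k, z k ^ 2) with h | h
  · have h1 : energyRatio b z - 1 = (∑ k, z k ^ 2 - ∑ k, b k * z k ^ 2) / ∑ k, b k * z k ^ 2 := by
      unfold energyRatio; field_simp
    have h2 : (n : ℝ) / ∑ k, b k * z k ^ 2 ≤ 2 * (1 + 1 / β₁) := by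
      rw [div_le_iff₀ hd]
      have : β₁ * (n / 2) ≤ ∑ k, b k * z k ^ 2 :=
        (mul_le_mul_of_nonneg_left h hβ₁.le).trans hdq
      have h3 : (n : ℝ) = 2 * (1 / β₁) * (β₁ * (n / 2)) := by field_simp
      have h4 : 2 * (1 / β₁) * (β₁ * (n / 2)) ≤ 2 * (1 / β₁) * ∑ k, b k * z k ^ 2 :=
        mul_le_mul_of_nonneg_left this (by positivity)
      nlinarith
    have h5 : ((n : ℝ) / ∑ k, b k * z k ^ 2) ^ 2 ≤ (2 * (1 + 1 / β₁)) ^ 2 :=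
      pow_le_pow_left₀ (by positivity) h2 2
    calc (energyRatio b z - 1) ^ 2 * (n : ℝ) ^ 2
        = (∑ k, z k ^ 2 - ∑ k, b k * z k ^ 2) ^ 2 * ((n : ℝ) / ∑ k, b k * z k ^ 2) ^ 2 := by
          rw [h1]; ring
      _ ≤ (∑ k, z k ^ 2 - ∑ k, b k * z k ^ 2) ^ 2 * (2 * (1 + 1 / β₁)) ^ 2 :=
          mul_le_mul_of_nonneg_left h5 (sq_nonneg _)
      _ ≤ _ := by
          nlinarith [mul_nonneg (sq_nonneg (1 + 1 / β₁)) (sq_nonneg (∑ k, z k ^ 2 - (n : ℝ)))]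
  · have h1 : (energyRatio b z - 1) ^ 2 ≤ (1 + 1 / β₁) ^ 2 := by
      apply sq_le_sq'  <;> linarith
    have h2 : (n : ℝ) ^ 2 ≤ 4 * (∑ k, z k ^ 2 - n) ^ 2 := by nlinarith
    calc (energyRatio b z - 1) ^ 2 * (n : ℝ) ^ 2
        ≤ (1 + 1 / β₁) ^ 2 * (4 * (∑ k, z k ^ 2 - n) ^ 2) := by gcongr
      _ ≤ _ := by
        nlinarith [mul_nonneg (sq_nonneg (1 + 1 / β₁))
          (sq_nonneg (∑ k, z k ^ 2 - ∑ k, b k * z k ^ 2))]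

/-- The error term which controls all approximations. Its integral is of order `1 / √n`. -/
def errorTerm (b : Fin n → ℝ) (i : Fin n) (z : Fin n → ℝ) : ℝ :=
  (z i ^ 2 + (z i ^ 2 - 1) ^ 2) / Real.sqrt n + energyDeviation b z / (n * Real.sqrt n)

lemma energyDeviation_nonneg : 0 ≤ energyDeviation b z := by
  unfold energyDeviation; positivity

lemma errorTerm_nonneg (i : Fin n) : 0 ≤ errorTerm b i z := by
  have := energyDeviation_nonneg (b := b) (z := z)
  unfold errorTerm; positivity

lemma sqrt_mul_sq_energyRatio_sub_one_le (hβ₁ : 0 < β₁) (hb₁ : ∀ k, β₁ ≤ b k) (hn : 0 < n)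
    (hz : z ≠ 0) (i : Fin n) :
    Real.sqrt n * (energyRatio b z - 1) ^ 2 +
      (z i ^ 2 + (z i ^ 2 - 1) ^ 2) / Real.sqrt n ≤ 4 * (1 + 1 / β₁) ^ 2 * errorTerm b i z := by
  have hn' : (0 : ℝ) < n := by exact_mod_cast hn
  have hs : 0 < Real.sqrt n := Real.sqrt_pos.2 hn'
  have hss : Real.sqrt n * Real.sqrt n = n := Real.mul_self_sqrt hn'.le
  have h1 := mul_le_mul_of_nonneg_left (sq_energyRatio_sub_one_le hβ₁ hb₁ hn hz) hs.le
  have h2 : Real.sqrt n * (4 * (1 + 1 / β₁) ^ 2 * (energyDeviation b z / (n : ℝ) ^ 2)) =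
      4 * (1 + 1 / β₁) ^ 2 * (energyDeviation b z / (n * Real.sqrt n)) := by
    field_simp
    linear_combination energyDeviation b z * hss
  have h3 : (1 : ℝ) ≤ 4 * (1 + 1 / β₁) ^ 2 := by
    have : 0 < 1 / β₁ := by positivity
    nlinarith
  have h4 : 0 ≤ (z i ^ 2 + (z i ^ 2 - 1) ^ 2) / Real.sqrt n := by positivity
  have h5 := mul_le_mul_of_nonneg_right h3 h4
  unfold errorTerm
  linarith

lemma two_mul_le_sqrt_mul_sq_add (hn : 0 < n) (u v : ℝ) :
    2 * (u * v) ≤ Real.sqrt n * u ^ 2 + v ^ 2 / Real.sqrt n := by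
  have hs : 0 < Real.sqrt n := Real.sqrt_pos.2 (by exact_mod_cast hn)
  have h : Real.sqrt n * u ^ 2 + v ^ 2 / Real.sqrt n - 2 * (u * v)
      = (Real.sqrt n * u - v) ^ 2 / Real.sqrt n := by
    field_simp; ring
  have : 0 ≤ (Real.sqrt n * u - v) ^ 2 / Real.sqrt n := by positivity
  linarith

lemma abs_sqrt_energyRatio_sub_one_mul_le (hβ₁ : 0 < β₁) (hb₁ : ∀ k, β₁ ≤ b k) (hn : 0 < n)
    (hz : z ≠ 0) (i : Fin n) :
    |Real.sqrt (energyRatio b z) - 1| * |z i| ≤ 4 * (1 + 1 / β₁) ^ 2 * errorTerm b i z := by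
  have h1 := abs_sqrt_sub_one_le (energyRatio_pos hβ₁ hb₁ hz).le
  have h2 := sqrt_mul_sq_energyRatio_sub_one_le hβ₁ hb₁ hn hz i
  have h3 := two_mul_le_sqrt_mul_sq_add hn |energyRatio b z - 1| |z i|
  have h4 : 0 ≤ (z i ^ 2 - 1) ^ 2 / Real.sqrt n := by positivity
  rw [add_div] at h2
  simp only [sq_abs] at h3
  have h5 := mul_le_mul_of_nonneg_right h1 (abs_nonneg (z i))
  have h6 : 0 ≤ |energyRatio b z - 1| * |z i| := by positivity
  linarith

lemma sum_mul_update_sq (c : Fin n → ℝ) (i : Fin n) (z : Fin n → ℝ) :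
    ∑ k, c k * Function.update z i 1 k ^ 2 = ∑ k, c k * z k ^ 2 - c i * (z i ^ 2 - 1) := by
  rw [← Finset.add_sum_erase _ _ (Finset.mem_univ i),
    ← Finset.add_sum_erase (Finset.univ : Finset (Fin n)) (fun k => c k * z k ^ 2)
      (Finset.mem_univ i), Function.update_self,
    Finset.sum_congr rfl (g := fun k => c k * z k ^ 2)]
  · ring
  · intro k hk
    rw [Function.update_of_ne (Finset.ne_of_mem_erase hk)]

lemma update_one_ne_zero (i : Fin n) (z : Fin n → ℝ) : Function.update z i 1 ≠ 0 := by
  intro h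
  have := congrFun h i
  simp at this

/-- Replacing one coordinate by `1` changes the energy ratio by `O(1 / ∑ z_k²)`. -/
lemma abs_energyRatio_sub_update_le (hβ₁ : 0 < β₁) (hb₁ : ∀ k, β₁ ≤ b k) (hb₂ : ∀ k, b k ≤ β₂)
    (hz : z ≠ 0) (i : Fin n) :
    |energyRatio b z - energyRatio b (Function.update z i 1)| ≤
      (1 + β₂ / β₁) * |z i ^ 2 - 1| / (β₁ * ∑ k, z k ^ 2) := by
  set z' := Function.update z i 1 with hz'
  have hz0 : z' ≠ 0 := update_one_ne_zero i z
  have hbpos : ∀ k, 0 < b k := fun k => hβ₁.trans_le (hb₁ k)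
  have hd := sum_mul_sq_pos hbpos hz
  have hd' := sum_mul_sq_pos hbpos hz0
  have hq := sum_sq_pos hz
  have e1 := sum_mul_update_sq b i z
  have e2 := sum_mul_update_sq (fun _ => 1) i z
  simp only [one_mul] at e2
  have hw0 := energyRatio_pos hβ₁ hb₁ hz0
  have hw1 := energyRatio_le hβ₁ hb₁ hz0
  have key : energyRatio b z - energyRatio b z' =
      (z i ^ 2 - 1) * (1 - b i * energyRatio b z') / ∑ k, b k * z k ^ 2 := by
    unfold energyRatio
    rw [← hz'] at e1 e2
    field_simp
    have e1' : ∑ k, b k * z k ^ 2 = ∑ k, b k * z' k ^ 2 + b i * (z i ^ 2 - 1) := by linarith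
    have e2' : ∑ k, z k ^ 2 = ∑ k, z' k ^ 2 + (z i ^ 2 - 1) := by linarith
    rw [e1', e2']
    ring
  have hβ₂ : 0 < β₂ := (hbpos i).trans_le (hb₂ i)
  have h1 : |1 - b i * energyRatio b z'| ≤ 1 + β₂ / β₁ := by
    have : b i * energyRatio b z' ≤ β₂ * (1 / β₁) :=
      mul_le_mul (hb₂ i) hw1 hw0.le hβ₂.le
    have h0 : 0 < b i * energyRatio b z' := mul_pos (hbpos i) hw0
    rw [mul_one_div] at this
    have hpos : 0 < β₂ / β₁ := by positivity
    rw [abs_le]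
    constructor <;> linarith
  rw [key, abs_div, abs_mul, abs_of_pos hd, mul_comm]
  refine div_le_div₀ (by positivity) ?_ (by positivity) (le_sum_mul_sq hb₁)
  exact mul_le_mul_of_nonneg_right h1 (abs_nonneg _)

/-- The weight barely depends on any single coordinate. -/
lemma abs_tiltWeight_sub_update_le (hβ₁ : 0 < β₁) (hb₁ : ∀ k, β₁ ≤ b k) (hb₂ : ∀ k, b k ≤ β₂)
    (hn : 0 < n) (hz : z ≠ 0) (i : Fin n) :
    |tiltWeight b z - tiltWeight b (Function.update z i 1)| ≤
      (4 + β₂ * (2 * (1 + β₂ / β₁) / β₁) * (1 + 2 * (1 + β₂ / β₁) / β₁) *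
        (4 * (1 + 1 / β₁) ^ 2)) * errorTerm b i z := by
  set z' := Function.update z i 1 with hz'
  have hz0 : z' ≠ 0 := update_one_ne_zero i z
  have hn' : (0 : ℝ) < n := by exact_mod_cast hn
  have hn1 : (1 : ℝ) ≤ n := by exact_mod_cast hn
  have hs : 0 < Real.sqrt n := Real.sqrt_pos.2 hn'
  have hs1 : 1 ≤ Real.sqrt n := Real.one_le_sqrt.2 hn1
  have hss : Real.sqrt n * Real.sqrt n = n := Real.mul_self_sqrt hn'.le
  have hβ₂ : 0 < β₂ := (hβ₁.trans_le (hb₁ i)).trans_le (hb₂ i)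
  have hE := errorTerm_nonneg (b := b) (z := z) i
  set D := 2 * (1 + β₂ / β₁) / β₁ with hD
  have hDpos : 0 < D := by positivity
  -- where `∑ z_k² < n / 2` the error term is at least `1 / 4`, and the weights lie in `[0, 1]`
  rcases le_or_gt ((n : ℝ) / 2) (∑ k, z k ^ 2) with h | h
  · set w := energyRatio b z with hw
    set w' := energyRatio b z' with hw'
    set δ := z i ^ 2 - 1 with hδ
    have h1 : |w - w'| ≤ D * |δ| / n := by
      refine (abs_energyRatio_sub_update_le hβ₁ hb₁ hb₂ hz i).trans ?_
      have h0 : β₁ * (n / 2) ≤ β₁ * ∑ k, z k ^ 2 := mul_le_mul_of_nonneg_left h hβ₁.le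
      calc _ ≤ (1 + β₂ / β₁) * |δ| / (β₁ * (n / 2)) :=
            div_le_div_of_nonneg_left (by positivity) (by positivity) h0
        _ = _ := by rw [hD]; field_simp
    have h2 : |tiltWeight b z - tiltWeight b z'| ≤
        (n : ℝ) / 2 * (β₂ * ((|w - 1| + |w' - 1|) * |w - w'|)) := by
      refine (abs_exp_sub_exp_le (tiltExponent_nonpos hβ₁ hb₁ hz)
        (tiltExponent_nonpos hβ₁ hb₁ hz0)).trans ?_
      rw [← mul_sub, abs_mul, abs_of_pos (by positivity : (0 : ℝ) < n / 2),
        add_sub_add_right_eq_sub]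
      refine mul_le_mul_of_nonneg_left ?_ (by positivity)
      exact abs_log_sub_self_sub_le (energyRatio_pos hβ₁ hb₁ hz) (energyRatio_pos hβ₁ hb₁ hz0)
        (one_le_mul_energyRatio hβ₁ hb₁ hb₂ hz) (one_le_mul_energyRatio hβ₁ hb₁ hb₂ hz0)
    have h3 : |w' - 1| ≤ |w - 1| + |w - w'| := by
      have : w' - 1 = (w - 1) - (w - w') := by ring
      rw [this]
      exact abs_sub _ _
    have h4 : (|w - 1| + |w' - 1|) * |w - w'| ≤
        (2 * |w - 1| + D * |δ| / n) * (D * |δ| / n) := by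
      refine mul_le_mul (by linarith) h1 (abs_nonneg _) (by positivity)
    have h5 : (n : ℝ) / 2 * (β₂ * ((2 * |w - 1| + D * |δ| / n) * (D * |δ| / n))) =
        β₂ * D / 2 * (2 * (|w - 1| * |δ|) + D * (|δ| ^ 2 / n)) := by
      field_simp
    have h6 := two_mul_le_sqrt_mul_sq_add hn |w - 1| |δ|
    have h7 := sqrt_mul_sq_energyRatio_sub_one_le hβ₁ hb₁ hn hz i
    set T := 4 * (1 + 1 / β₁) ^ 2 * errorTerm b i z with hT
    simp only [sq_abs] at h5 h6
    rw [add_div, ← hw, ← hδ] at h7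
    have h8 : 0 ≤ z i ^ 2 / Real.sqrt n := by positivity
    have h8' : 0 ≤ Real.sqrt n * (w - 1) ^ 2 := by positivity
    have h9 : δ ^ 2 / n ≤ δ ^ 2 / Real.sqrt n := by
      refine div_le_div_of_nonneg_left (sq_nonneg _) hs ?_
      nlinarith
    have h10 : 2 * (|w - 1| * |δ|) + D * (δ ^ 2 / n) ≤ (1 + D) * T := by
      have : D * (δ ^ 2 / n) ≤ D * T := mul_le_mul_of_nonneg_left (by linarith) hDpos.le
      linarith
    have hTnn : 0 ≤ T := by rw [hT]; positivity
    calc |tiltWeight b z - tiltWeight b z'|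
        ≤ (n : ℝ) / 2 * (β₂ * ((2 * |w - 1| + D * |δ| / n) * (D * |δ| / n))) := by
          refine h2.trans ?_
          gcongr
      _ ≤ β₂ * D / 2 * ((1 + D) * T) := by
          rw [h5]; exact mul_le_mul_of_nonneg_left h10 (by positivity)
      _ ≤ β₂ * D * ((1 + D) * T) := by
          have : 0 ≤ β₂ * D * ((1 + D) * T) := by positivity
          nlinarith
      _ ≤ _ := by
          have : (4 + β₂ * D * (1 + D) * (4 * (1 + 1 / β₁) ^ 2)) * errorTerm b i z =
            4 * errorTerm b i z + β₂ * D * ((1 + D) * T) := by rw [hT]; ring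
          rw [this]
          linarith
  · have h1 : |tiltWeight b z - tiltWeight b z'| ≤ 1 := by
      have p1 := tiltWeight_pos (b := b) (z := z)
      have p2 := tiltWeight_pos (b := b) (z := z')
      have q1 := tiltWeight_le_one hβ₁ hb₁ hz
      have q2 := tiltWeight_le_one hβ₁ hb₁ hz0
      rw [abs_le]
      constructor <;> linarith
    have h2 : (1 : ℝ) ≤ 4 * errorTerm b i z := by
      have h3 : (n : ℝ) ^ 2 / 4 ≤ energyDeviation b z := by
        unfold energyDeviation
        nlinarith [sq_nonneg (∑ k, z k ^ 2 - ∑ k, b k * z k ^ 2)]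
      have h4 : 1 / 4 ≤ energyDeviation b z / (n * Real.sqrt n) := by
        rw [le_div_iff₀ (by positivity)]
        have : (n : ℝ) * Real.sqrt n ≤ n ^ 2 := by
          rw [sq]
          refine mul_le_mul_of_nonneg_left ?_ hn'.le
          nlinarith
        linarith
      have h5 : 0 ≤ (z i ^ 2 + (z i ^ 2 - 1) ^ 2) / Real.sqrt n := by positivity
      unfold errorTerm
      linarith
    have h6 : 0 ≤ β₂ * D * (1 + D) * (4 * (1 + 1 / β₁) ^ 2) * errorTerm b i z := by positivity
    linarith

/-- A lower bound of order one for the weight, since `√n` times the error term has bounded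
expectation. -/
lemma exp_neg_errorTerm_le_tiltWeight (hβ₁ : 0 < β₁) (hb₁ : ∀ k, β₁ ≤ b k)
    (hb₂ : ∀ k, b k ≤ β₂) (hn : 0 < n) (hz : z ≠ 0) (i : Fin n) :
    Real.exp (-(β₂ * (4 * (1 + 1 / β₁) ^ 2) * (Real.sqrt n * errorTerm b i z))) ≤
      tiltWeight b z := by
  have hn' : (0 : ℝ) < n := by exact_mod_cast hn
  have hs : 0 < Real.sqrt n := Real.sqrt_pos.2 hn'
  have hss : Real.sqrt n * Real.sqrt n = n := Real.mul_self_sqrt hn'.le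
  have hβ₂ : 0 < β₂ := (hβ₁.trans_le (hb₁ i)).trans_le (hb₂ i)
  have h1 := neg_sq_le_log_sub_self (energyRatio_pos hβ₁ hb₁ hz)
    (one_le_mul_energyRatio hβ₁ hb₁ hb₂ hz)
  have h2 := sqrt_mul_sq_energyRatio_sub_one_le hβ₁ hb₁ hn hz i
  have h3 : 0 ≤ (z i ^ 2 + (z i ^ 2 - 1) ^ 2) / Real.sqrt n := by positivity
  set w := energyRatio b z with hw
  have h4 : Real.sqrt n * (w - 1) ^ 2 ≤ 4 * (1 + 1 / β₁) ^ 2 * errorTerm b i z := by linarith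
  have h5 := mul_le_mul_of_nonneg_left h4 (mul_nonneg hβ₂.le hs.le)
  have h6 : β₂ * Real.sqrt n * (Real.sqrt n * (w - 1) ^ 2) = n * (β₂ * (w - 1) ^ 2) := by
    linear_combination β₂ * (w - 1) ^ 2 * hss
  unfold tiltWeight
  refine Real.exp_le_exp.2 ?_
  have h7 := mul_le_mul_of_nonneg_left h1 (by positivity : (0 : ℝ) ≤ n / 2)
  have h8 : 0 ≤ (n : ℝ) * (β₂ * (w - 1) ^ 2) := by positivity
  nlinarith

end Pointwise

/-! ### Moments and asymptotic independence -/

lemma memLp_sq_sub_one_gaussianReal : MemLp (fun x : ℝ => x ^ 2 - 1) 2 (gaussianReal 0 1) := by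
  have h4 : MemLp (id : ℝ → ℝ) 4 (gaussianReal 0 1) := memLp_id_gaussianReal' 4 (by norm_num)
  refine MemLp.sub ?_ (memLp_const 1)
  have : MemLp ((id : ℝ → ℝ) * id) 2 (gaussianReal 0 1) := by
    have : ENNReal.HolderTriple 4 4 2 := ⟨by
      rw [← two_mul, show (4 : ℝ≥0∞) = 2 * 2 by norm_num, ENNReal.mul_inv (by simp) (by simp),
        ← mul_assoc, ENNReal.mul_inv_cancel (by simp) (by simp), one_mul]⟩
    exact h4.mul h4
  refine this.ae_eq (ae_of_all _ fun x => ?_)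
  simp [sq]

lemma integral_sq_gaussianReal : ∫ x, x ^ 2 ∂(gaussianReal 0 1) = 1 := by
  have h := variance_fun_id_gaussianReal (μ := 0) (v := 1)
  rw [variance_of_integral_eq_zero (by fun_prop) (by simp)] at h
  simpa using h

lemma integrable_sq_gaussianReal : Integrable (fun x : ℝ => x ^ 2) (gaussianReal 0 1) :=
  (memLp_id_gaussianReal' 2 (by norm_num)).integrable_sq

lemma integral_sq_sub_one_gaussianReal : ∫ x, (x ^ 2 - 1) ∂(gaussianReal 0 1) = 0 := by
  rw [integral_sub integrable_sq_gaussianReal (integrable_const _), integral_sq_gaussianReal]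
  simp

/-- The variance of `x²` for a standard normal `x`. -/
def sqVariance : ℝ := ∫ x, (x ^ 2 - 1) ^ 2 ∂(gaussianReal 0 1)

lemma sqVariance_nonneg : 0 ≤ sqVariance := integral_nonneg fun _ => sq_nonneg _

lemma memLp_sum_mul_sq_sub_one {n : ℕ} (c : Fin n → ℝ) :
    MemLp (fun z : Fin n → ℝ => ∑ k, c k * (z k ^ 2 - 1)) 2 (gaussianProduct n) := by
  refine memLp_finsetSum _ fun k _ => ?_
  exact (memLp_sq_sub_one_gaussianReal.comp_measurePreserving
    (measurePreserving_eval (fun _ : Fin n => gaussianReal 0 1) k)).const_mul (c k)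

lemma integral_sum_mul_sq_sub_one_sq {n : ℕ} (c : Fin n → ℝ) :
    ∫ z, (∑ k, c k * (z k ^ 2 - 1)) ^ 2 ∂(gaussianProduct n) = sqVariance * ∑ k, c k ^ 2 := by
  have hL := memLp_sum_mul_sq_sub_one c
  have hint : ∀ k : Fin n, Integrable (fun z : Fin n → ℝ => c k * (z k ^ 2 - 1))
      (gaussianProduct n) := fun k =>
    ((memLp_sq_sub_one_gaussianReal.comp_measurePreserving
      (measurePreserving_eval (fun _ : Fin n => gaussianReal 0 1) k)).const_mul (c k)).integrable
        (by norm_num)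
  have h0 : ∫ z, ∑ k, c k * (z k ^ 2 - 1) ∂(gaussianProduct n) = 0 := by
    rw [integral_finsetSum _ fun k _ => hint k]
    refine Finset.sum_eq_zero fun k _ => ?_
    rw [integral_const_mul]
    unfold gaussianProduct
    rw [integral_comp_eval (μ := fun _ : Fin n => gaussianReal 0 1) (f := fun x : ℝ => x ^ 2 - 1)
      (by fun_prop), integral_sq_sub_one_gaussianReal, mul_zero]
  have hv := variance_sum_pi (μ := fun _ : Fin n => gaussianReal 0 1)
    (X := fun k x => c k * (x ^ 2 - 1)) (fun k => memLp_sq_sub_one_gaussianReal.const_mul (c k))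
  have he : (∑ k, fun z : Fin n → ℝ => c k * (z k ^ 2 - 1)) =
      fun z : Fin n → ℝ => ∑ k, c k * (z k ^ 2 - 1) := by
    ext z; simp
  rw [he] at hv
  change Var[_; gaussianProduct n] = _ at hv
  rw [variance_of_integral_eq_zero hL.aestronglyMeasurable.aemeasurable h0] at hv
  rw [hv, Finset.mul_sum]
  refine Finset.sum_congr rfl fun k _ => ?_
  rw [variance_const_mul, variance_of_integral_eq_zero (by fun_prop)
    integral_sq_sub_one_gaussianReal, mul_comm]
  rfl

lemma integrable_sum_mul_sq_sub_one_sq {n : ℕ} (c : Fin n → ℝ) :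
    Integrable (fun z : Fin n → ℝ => (∑ k, c k * (z k ^ 2 - 1)) ^ 2) (gaussianProduct n) :=
  (memLp_sum_mul_sq_sub_one c).integrable_sq

lemma energyDeviation_eq {n : ℕ} (b z : Fin n → ℝ) :
    energyDeviation b z = (∑ k, (1 - b k) * (z k ^ 2 - 1) + ∑ k, (1 - b k)) ^ 2 +
      (∑ k, (1 : ℝ) * (z k ^ 2 - 1)) ^ 2 := by
  unfold energyDeviation
  congr 2
  · rw [← Finset.sum_sub_distrib, ← Finset.sum_add_distrib]
    exact Finset.sum_congr rfl fun k _ => by ring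
  · simp

lemma integrable_energyDeviation {n : ℕ} (b : Fin n → ℝ) :
    Integrable (energyDeviation b) (gaussianProduct n) := by
  have h : energyDeviation b = fun z => (∑ k, (1 - b k) * (z k ^ 2 - 1) + ∑ k, (1 - b k)) ^ 2 +
      (∑ k, (1 : ℝ) * (z k ^ 2 - 1)) ^ 2 := funext fun z => energyDeviation_eq b z
  rw [h]
  exact ((memLp_sum_mul_sq_sub_one fun k => 1 - b k).add (memLp_const _)).integrable_sq.add
    (integrable_sum_mul_sq_sub_one_sq fun _ => 1)

lemma integral_energyDeviation_le {n : ℕ} (hn : 0 < n) {b : Fin n → ℝ} {β K : ℝ}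
    (hb0 : ∀ k, 0 ≤ b k) (hb : ∀ k, b k ≤ β) (hK : |∑ k, (1 - b k)| ≤ K) :
    ∫ z, energyDeviation b z ∂(gaussianProduct n) ≤
      (2 * (sqVariance * (1 + β) ^ 2 + K ^ 2) + sqVariance) * n := by
  have hn1 : (1 : ℝ) ≤ n := by exact_mod_cast hn
  have hβ : 0 ≤ β := (hb0 ⟨0, hn⟩).trans (hb ⟨0, hn⟩)
  set m := ∑ k, (1 - b k) with hm
  have hm2 : m ^ 2 ≤ K ^ 2 := by
    rw [← sq_abs m]; exact pow_le_pow_left₀ (abs_nonneg _) hK 2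
  have hpt : ∀ z, energyDeviation b z ≤ 2 * (∑ k, (1 - b k) * (z k ^ 2 - 1)) ^ 2 + 2 * K ^ 2 +
      (∑ k, (1 : ℝ) * (z k ^ 2 - 1)) ^ 2 := by
    intro z
    rw [energyDeviation_eq]
    nlinarith [sq_nonneg (∑ k, (1 - b k) * (z k ^ 2 - 1) - m)]
  have i1 := (integrable_sum_mul_sq_sub_one_sq fun k => 1 - b k).const_mul 2
  have i2 := integrable_sum_mul_sq_sub_one_sq fun _ : Fin n => (1 : ℝ)
  have i12 : Integrable (fun z : Fin n → ℝ => 2 * (∑ k, (1 - b k) * (z k ^ 2 - 1)) ^ 2 +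
      2 * K ^ 2) (gaussianProduct n) := i1.add (integrable_const _)
  refine (integral_mono (integrable_energyDeviation b) (i12.add i2) hpt).trans ?_
  have e : ∫ z, (2 * (∑ k, (1 - b k) * (z k ^ 2 - 1)) ^ 2 + 2 * K ^ 2 +
      (∑ k, (1 : ℝ) * (z k ^ 2 - 1)) ^ 2) ∂(gaussianProduct n) =
      2 * (sqVariance * ∑ k, (1 - b k) ^ 2) + 2 * K ^ 2 +
        sqVariance * ∑ _k : Fin n, (1 : ℝ) ^ 2 := by
    rw [integral_add i12 i2, integral_add i1 (integrable_const _),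
      integral_const_mul, integral_sum_mul_sq_sub_one_sq, integral_sum_mul_sq_sub_one_sq]
    simp
  refine (le_of_eq e).trans ?_
  have h1 : ∑ k, (1 - b k) ^ 2 ≤ (1 + β) ^ 2 * n := by
    have : ∀ k, (1 - b k) ^ 2 ≤ (1 + β) ^ 2 := fun k => by
      apply sq_le_sq' <;> linarith [hb0 k, hb k]
    calc _ ≤ ∑ _k : Fin n, (1 + β) ^ 2 := Finset.sum_le_sum fun k _ => this k
      _ = _ := by simp [mul_comm]
  have h2 := mul_le_mul_of_nonneg_left h1 sqVariance_nonneg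
  have h3 : ∑ _k : Fin n, (1 : ℝ) ^ 2 = n := by simp
  rw [h3]
  nlinarith [sq_nonneg K]

lemma integrable_errorTerm {n : ℕ} (b : Fin n → ℝ) (i : Fin n) :
    Integrable (errorTerm b i) (gaussianProduct n) := by
  have h1 : Integrable (fun x : ℝ => x ^ 2 + (x ^ 2 - 1) ^ 2) (gaussianReal 0 1) :=
    integrable_sq_gaussianReal.add memLp_sq_sub_one_gaussianReal.integrable_sq
  have h2 : Integrable (fun z : Fin n → ℝ => z i ^ 2 + (z i ^ 2 - 1) ^ 2) (gaussianProduct n) :=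
    (measurePreserving_eval (fun _ : Fin n => gaussianReal 0 1) i).integrable_comp_of_integrable h1
  exact (h2.div_const _).add ((integrable_energyDeviation b).div_const _)

/-- The expected error is `O(1 / √n)`, with an explicit constant. -/
lemma integral_errorTerm_le {n : ℕ} (hn : 0 < n) {b : Fin n → ℝ} {β K : ℝ} (i : Fin n)
    (hb0 : ∀ k, 0 ≤ b k) (hb : ∀ k, b k ≤ β) (hK : |∑ k, (1 - b k)| ≤ K) :
    ∫ z, errorTerm b i z ∂(gaussianProduct n) ≤
      (1 + sqVariance + (2 * (sqVariance * (1 + β) ^ 2 + K ^ 2) + sqVariance)) / Real.sqrt n := by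
  have hn' : (0 : ℝ) < n := by exact_mod_cast hn
  have hs : 0 < Real.sqrt n := Real.sqrt_pos.2 hn'
  have h1 : Integrable (fun x : ℝ => x ^ 2 + (x ^ 2 - 1) ^ 2) (gaussianReal 0 1) :=
    integrable_sq_gaussianReal.add memLp_sq_sub_one_gaussianReal.integrable_sq
  have h2 : Integrable (fun z : Fin n → ℝ => z i ^ 2 + (z i ^ 2 - 1) ^ 2) (gaussianProduct n) :=
    (measurePreserving_eval (fun _ : Fin n => gaussianReal 0 1) i).integrable_comp_of_integrable h1
  have h3 : ∫ z : Fin n → ℝ, (z i ^ 2 + (z i ^ 2 - 1) ^ 2) ∂(gaussianProduct n) =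
      1 + sqVariance := by
    unfold gaussianProduct
    rw [integral_comp_eval (μ := fun _ : Fin n => gaussianReal 0 1)
      (f := fun x : ℝ => x ^ 2 + (x ^ 2 - 1) ^ 2) (by fun_prop),
      integral_add integrable_sq_gaussianReal memLp_sq_sub_one_gaussianReal.integrable_sq,
      integral_sq_gaussianReal]
    rfl
  unfold errorTerm
  rw [integral_add (h2.div_const _) ((integrable_energyDeviation b).div_const _),
    integral_div, integral_div, h3, add_div (1 + sqVariance) (2 * _ + _)]
  refine add_le_add (le_refl _) ?_
  rw [div_le_div_iff₀ (by positivity) hs]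
  have := mul_le_mul_of_nonneg_right (integral_energyDeviation_le hn hb0 hb hK) hs.le
  linarith

lemma ae_gaussianProduct_ne_zero {n : ℕ} (hn : 0 < n) :
    ∀ᵐ x ∂(gaussianProduct n), x ≠ 0 := by
  rw [gaussianProduct_eq_withDensity]
  exact (withDensity_absolutelyContinuous _ _).ae_le (ae_volume_ne_zero hn)

lemma measurable_update_one {n : ℕ} (i : Fin n) :
    Measurable fun z : Fin n → ℝ => Function.update z i 1 :=
  measurable_update_left

/-- A coordinate is independent of the vector in which that coordinate has been overwritten. -/
lemma indepFun_eval_update {n : ℕ} (i : Fin n) :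
    IndepFun (fun z : Fin n → ℝ => z i) (fun z => Function.update z i 1) (gaussianProduct n) := by
  have h : iIndepFun (fun (k : Fin n) (z : Fin n → ℝ) => z k) (gaussianProduct n) :=
    iIndepFun_pi (X := fun _ => id) fun _ => aemeasurable_id
  have h2 := h.indepFun_finset {i} ({i}ᶜ : Finset (Fin n)) disjoint_compl_right
    fun k => measurable_pi_apply k
  have m1 : Measurable fun v : ({i} : Finset (Fin n)) → ℝ => v ⟨i, Finset.mem_singleton_self i⟩ :=
    measurable_pi_apply _
  have m2 : Measurable fun (v : ({i}ᶜ : Finset (Fin n)) → ℝ) (k : Fin n) =>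
      if hk : k ∈ ({i}ᶜ : Finset (Fin n)) then v ⟨k, hk⟩ else 1 := by
    refine measurable_pi_lambda _ fun k => ?_
    by_cases hk : k ∈ ({i}ᶜ : Finset (Fin n))
    · simpa only [hk, dite_true] using measurable_pi_apply _
    · simp only [hk, dite_false]; exact measurable_const
  have h3 := h2.comp m1 m2
  refine h3.congr (ae_of_all _ fun z => rfl) (ae_of_all _ fun z => ?_)
  ext k
  by_cases hk : k = i
  · subst hk; simp
  · simp [hk]

/-- Under the tilted law of a standard Gaussian vector, `√w √b_i z_i` has almost the same law as
`√b_i z_i` under the Gaussian law itself: the tilt is asymptotically independent of `z_i`, and `w`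
is close to `1`. -/
lemma exists_abs_tilted_sub_le {β₁ β₂ K : ℝ} (hβ₁ : 0 < β₁) (hβ₁₂ : β₁ ≤ β₂)
    {f : ℝ → ℝ} {B : ℝ} {L : ℝ≥0} (hB : ∀ x, |f x| ≤ B) (hL : LipschitzWith L f) :
    ∃ C : ℝ, ∀ (n : ℕ) (_ : 0 < n) (b : Fin n → ℝ) (i : Fin n) (_ : ∀ k, β₁ ≤ b k)
      (_ : ∀ k, b k ≤ β₂) (_ : |∑ k, (1 - b k)| ≤ K),
      |(∫ z, f (Real.sqrt (energyRatio b z) * (Real.sqrt (b i) * z i)) * tiltWeight b z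
          ∂(gaussianProduct n)) / (∫ z, tiltWeight b z ∂(gaussianProduct n)) -
        ∫ z, f (Real.sqrt (b i) * z i) ∂(gaussianProduct n)| ≤ C / Real.sqrt n := by
  have hβ₂ : 0 < β₂ := hβ₁.trans_le hβ₁₂
  have hB0 : 0 ≤ B := (abs_nonneg _).trans (hB 0)
  set A₁ : ℝ := 4 * (1 + 1 / β₁) ^ 2 with hA₁
  set A₂ : ℝ := 4 + β₂ * (2 * (1 + β₂ / β₁) / β₁) * (1 + 2 * (1 + β₂ / β₁) / β₁) *
        (4 * (1 + 1 / β₁) ^ 2) with hA₂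
  set E : ℝ := 1 + sqVariance + (2 * (sqVariance * (1 + β₂) ^ 2 + K ^ 2) + sqVariance) with hE
  have hA₁0 : 0 < A₁ := by positivity
  have hA₂0 : 0 < A₂ := by positivity
  refine ⟨(L * Real.sqrt β₂ * A₁ + 2 * B * A₂) * E / Real.exp (-(β₂ * A₁ * E)), ?_⟩
  intro n hn b i hb₁ hb₂ hK
  have hn' : (0 : ℝ) < n := by exact_mod_cast hn
  have hs : 0 < Real.sqrt n := Real.sqrt_pos.2 hn'
  set γ := gaussianProduct n with hγ
  have hne := ae_gaussianProduct_ne_zero hn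
  have hR := integrable_errorTerm b i
  have hRle := integral_errorTerm_le hn i (fun k => hβ₁.le.trans (hb₁ k)) hb₂ hK
  rw [← hE, ← hγ] at hRle
  rw [← hγ] at hR
  set G := tiltWeight b with hG
  set G' : (Fin n → ℝ) → ℝ := fun z => G (Function.update z i 1) with hG'
  set Y : (Fin n → ℝ) → ℝ := fun z => Real.sqrt (b i) * z i with hY
  set Y' : (Fin n → ℝ) → ℝ := fun z => Real.sqrt (energyRatio b z) * Y z with hY'
  have hGm : Measurable G := measurable_tiltWeight b
  have hG'm : Measurable G' := hGm.comp (measurable_update_one i)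
  have hYm : Measurable Y := by fun_prop
  have hY'm : Measurable Y' := (measurable_energyRatio b).sqrt.mul hYm
  have hfm : Measurable f := hL.continuous.measurable
  have hGb : ∀ᵐ z ∂γ, |G z| ≤ 1 := by
    filter_upwards [hne] with z hz
    rw [abs_of_pos tiltWeight_pos]
    exact tiltWeight_le_one hβ₁ hb₁ hz
  have hG'b : ∀ z, |G' z| ≤ 1 := fun z => by
    rw [abs_of_pos tiltWeight_pos]
    exact tiltWeight_le_one hβ₁ hb₁ (update_one_ne_zero i z)
  have iG : Integrable G γ := Integrable.of_bound hGm.aestronglyMeasurable 1 hGb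
  have iG' : Integrable G' γ :=
    Integrable.of_bound hG'm.aestronglyMeasurable 1 (ae_of_all _ hG'b)
  have hprod : ∀ {u v : (Fin n → ℝ) → ℝ}, Measurable u → Measurable v → (∀ z, |u z| ≤ B) →
      (∀ᵐ z ∂γ, |v z| ≤ 1) → Integrable (fun z => u z * v z) γ := by
    intro u v hu hv hub hvb
    refine Integrable.of_bound (hu.mul hv).aestronglyMeasurable B ?_
    filter_upwards [hvb] with z hz
    rw [Real.norm_eq_abs, abs_mul]
    exact (mul_le_mul (hub z) hz (abs_nonneg _) hB0).trans (mul_one B).le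
  have i1 : Integrable (fun z => f (Y' z) * G z) γ :=
    hprod (hfm.comp hY'm) hGm (fun z => hB _) hGb
  have i2 : Integrable (fun z => f (Y z) * G z) γ :=
    hprod (hfm.comp hYm) hGm (fun z => hB _) hGb
  have i3 : Integrable (fun z => f (Y z) * G' z) γ :=
    hprod (hfm.comp hYm) hG'm (fun z => hB _) (ae_of_all _ hG'b)
  have iR1 : Integrable (fun z => (L * Real.sqrt β₂ * A₁) * errorTerm b i z) γ := hR.const_mul _
  -- the scaling factor `√w` costs only the error term
  have b1 : |∫ z, f (Y' z) * G z ∂γ - ∫ z, f (Y z) * G z ∂γ| ≤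
      L * Real.sqrt β₂ * A₁ * ∫ z, errorTerm b i z ∂γ := by
    rw [← integral_sub i1 i2, ← integral_const_mul, ← Real.norm_eq_abs]
    refine norm_integral_le_of_norm_le iR1 ?_
    filter_upwards [hne, hGb] with z hz hgz
    rw [← sub_mul, Real.norm_eq_abs, abs_mul]
    have h1 : |f (Y' z) - f (Y z)| ≤ L * |Y' z - Y z| := by
      simpa only [Real.dist_eq] using hL.dist_le_mul (Y' z) (Y z)
    have h2 : |Y' z - Y z| = Real.sqrt (b i) * (|Real.sqrt (energyRatio b z) - 1| * |z i|) := by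
      have : Y' z - Y z = Real.sqrt (b i) * ((Real.sqrt (energyRatio b z) - 1) * z i) := by
        simp only [hY', hY]; ring
      rw [this, abs_mul, abs_mul, abs_of_nonneg (Real.sqrt_nonneg _)]
    have h3 : |Y' z - Y z| ≤ Real.sqrt β₂ * (A₁ * errorTerm b i z) := by
      rw [h2]
      exact mul_le_mul (Real.sqrt_le_sqrt (hb₂ i))
        (abs_sqrt_energyRatio_sub_one_mul_le hβ₁ hb₁ hn hz i) (by positivity) (Real.sqrt_nonneg _)
    calc |f (Y' z) - f (Y z)| * |G z| ≤ |f (Y' z) - f (Y z)| * 1 :=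
          mul_le_mul_of_nonneg_left hgz (abs_nonneg _)
      _ ≤ L * (Real.sqrt β₂ * (A₁ * errorTerm b i z)) := by
          rw [mul_one]
          exact h1.trans (mul_le_mul_of_nonneg_left h3 L.2)
      _ = _ := by ring
  have hGG' : ∀ᵐ z ∂γ, |G z - G' z| ≤ A₂ * errorTerm b i z := by
    filter_upwards [hne] with z hz
    exact abs_tiltWeight_sub_update_le hβ₁ hb₁ hb₂ hn hz i
  have b2 : |∫ z, f (Y z) * G z ∂γ - ∫ z, f (Y z) * G' z ∂γ| ≤
      B * A₂ * ∫ z, errorTerm b i z ∂γ := by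
    rw [← integral_sub i2 i3, ← integral_const_mul, ← Real.norm_eq_abs]
    refine norm_integral_le_of_norm_le (hR.const_mul _) ?_
    filter_upwards [hGG'] with z hz
    rw [← mul_sub, Real.norm_eq_abs, abs_mul, mul_assoc]
    exact mul_le_mul (hB _) hz (abs_nonneg _) hB0
  have b3 : |∫ z, G' z ∂γ - ∫ z, G z ∂γ| ≤ A₂ * ∫ z, errorTerm b i z ∂γ := by
    rw [abs_sub_comm, ← integral_sub iG iG', ← integral_const_mul, ← Real.norm_eq_abs]
    exact norm_integral_le_of_norm_le (hR.const_mul _) hGG'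
  have hind : ∫ z, f (Y z) * G' z ∂γ = (∫ z, f (Y z) ∂γ) * ∫ z, G' z ∂γ := by
    have h := (indepFun_eval_update i).comp (φ := fun x => f (Real.sqrt (b i) * x)) (ψ := G)
      (hfm.comp (measurable_const.mul measurable_id)) hGm
    exact h.integral_fun_mul_eq_mul_integral
      (hfm.comp hYm).aestronglyMeasurable hG'm.aestronglyMeasurable
  have hfY : |∫ z, f (Y z) ∂γ| ≤ B := by
    have := norm_integral_le_of_norm_le_const (μ := γ) (f := fun z => f (Y z))
      (ae_of_all _ fun z => hB (Y z))
    simpa using this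
  -- a lower bound for the total mass, from `exp (-x) ≥ exp (-a) (1 + a - x)`
  have hlow : Real.exp (-(β₂ * A₁ * E)) ≤ ∫ z, G z ∂γ := by
    set a := β₂ * A₁ * E with ha
    have iX : Integrable (fun z => Real.exp (-a) *
        (1 + a - β₂ * A₁ * Real.sqrt n * errorTerm b i z)) γ :=
      ((integrable_const _).sub (hR.const_mul _)).const_mul _
    have hle : ∫ z, Real.exp (-a) * (1 + a - β₂ * A₁ * Real.sqrt n * errorTerm b i z) ∂γ ≤
        ∫ z, G z ∂γ := by
      refine integral_mono_ae iX iG ?_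
      filter_upwards [hne] with z hz
      refine le_trans ?_ (exp_neg_errorTerm_le_tiltWeight hβ₁ hb₁ hb₂ hn hz i)
      set X := β₂ * A₁ * Real.sqrt n * errorTerm b i z with hX
      have h0 : β₂ * (4 * (1 + 1 / β₁) ^ 2) * (Real.sqrt n * errorTerm b i z) = X := by
        rw [hX, hA₁]; ring
      rw [h0]
      have h1 := Real.add_one_le_exp (a - X)
      have h2 : Real.exp (-X) = Real.exp (-a) * Real.exp (a - X) := by
        rw [← Real.exp_add]; ring_nf
      rw [h2]
      exact mul_le_mul_of_nonneg_left (by linarith) (Real.exp_pos _).le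
    refine le_trans ?_ hle
    rw [integral_const_mul, integral_sub (integrable_const _) (hR.const_mul _),
      integral_const_mul]
    have h3 : β₂ * A₁ * Real.sqrt n * ∫ z, errorTerm b i z ∂γ ≤ a := by
      calc _ ≤ β₂ * A₁ * Real.sqrt n * (E / Real.sqrt n) :=
            mul_le_mul_of_nonneg_left hRle (by positivity)
        _ = a := by rw [ha]; field_simp
    simp only [integral_const, probReal_univ, one_smul]
    refine le_mul_of_one_le_right (Real.exp_pos _).le (by linarith)
  set e := Real.exp (-(β₂ * A₁ * E)) with he
  have he0 : 0 < e := Real.exp_pos _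
  set I := ∫ z, G z ∂γ with hI
  have hI0 : 0 < I := he0.trans_le hlow
  set R := ∫ z, errorTerm b i z ∂γ with hRdef
  have hR0 : 0 ≤ R := integral_nonneg fun z => errorTerm_nonneg i
  have hnum : |∫ z, f (Y' z) * G z ∂γ - (∫ z, f (Y z) ∂γ) * I| ≤
      (L * Real.sqrt β₂ * A₁ + 2 * B * A₂) * R := by
    have h1 : ∫ z, f (Y' z) * G z ∂γ - (∫ z, f (Y z) ∂γ) * I =
        (∫ z, f (Y' z) * G z ∂γ - ∫ z, f (Y z) * G z ∂γ) +
        (∫ z, f (Y z) * G z ∂γ - ∫ z, f (Y z) * G' z ∂γ) +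
        (∫ z, f (Y z) ∂γ) * (∫ z, G' z ∂γ - I) := by rw [hind]; ring
    have h2 : |(∫ z, f (Y z) ∂γ) * (∫ z, G' z ∂γ - I)| ≤ B * (A₂ * R) := by
      rw [abs_mul]
      exact mul_le_mul hfY b3 (abs_nonneg _) hB0
    rw [h1]
    refine (abs_add_three _ _ _).trans ?_
    linarith
  have hfin : (∫ z, f (Y' z) * G z ∂γ) / I - ∫ z, f (Y z) ∂γ =
      (∫ z, f (Y' z) * G z ∂γ - (∫ z, f (Y z) ∂γ) * I) / I := by field_simp
  change |(∫ z, f (Y' z) * G z ∂γ) / I - ∫ z, f (Y z) ∂γ| ≤ _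
  rw [hfin, abs_div, abs_of_pos hI0]
  have hcoef : 0 ≤ L * Real.sqrt β₂ * A₁ + 2 * B * A₂ := by positivity
  calc _ ≤ (L * Real.sqrt β₂ * A₁ + 2 * B * A₂) * (E / Real.sqrt n) / e := by
        refine div_le_div₀ ?_ (hnum.trans (mul_le_mul_of_nonneg_left hRle hcoef)) he0 hlow
        exact mul_nonneg hcoef (hR0.trans hRle)
    _ = _ := by ring

/-- Expectations of functions of `S_n / √n` in the spin model are expectations under the tilted law
of a standard Gaussian vector. -/
lemma integral_spinLaw_eq {n : ℕ} (hn : 0 < n) (r : ℕ) {s : ℝ} (hs : 1 < s) {f : ℝ → ℝ}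
    (hf : Measurable f) :
    ∫ x, f (magnetization n x / Real.sqrt n) ∂(spinLaw r n) =
      (∫ z, f (Real.sqrt (energyRatio (modeVariance r n s) z) *
          (Real.sqrt (modeVariance r n s ⟨0, hn⟩) * z ⟨0, hn⟩)) * tiltWeight (modeVariance r n s) z
          ∂(gaussianProduct n)) /
        ∫ z, tiltWeight (modeVariance r n s) z ∂(gaussianProduct n) := by
  obtain ⟨C, hC⟩ := exists_lintegral_weight_eq hn r hs
  set b := modeVariance r n s with hb
  set X : (Fin n → ℝ) → ℝ := fun x => magnetization n x / Real.sqrt n with hX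
  set Y : (Fin n → ℝ) → ℝ := fun z => Real.sqrt (energyRatio b z) *
    (Real.sqrt (b ⟨0, hn⟩) * z ⟨0, hn⟩) with hY
  have hXm : Measurable X := by simp only [hX, magnetization]; fun_prop
  have hYm : Measurable Y := (measurable_energyRatio b).sqrt.mul (by fun_prop)
  have hwm := (measurable_weight r n).ennreal_ofReal
  have hGm := (measurable_tiltWeight b).ennreal_ofReal
  have hlaw : ((gaussianProduct n).withDensity fun x => ENNReal.ofReal (weight r n x)).map X =
      C • ((gaussianProduct n).withDensity fun z => ENNReal.ofReal (tiltWeight b z)).map Y := by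
    ext S hS
    rw [Measure.smul_apply, Measure.map_apply hXm hS, Measure.map_apply hYm hS,
      withDensity_apply _ (hXm hS), withDensity_apply _ (hYm hS),
      ← lintegral_indicator (hXm hS), ← lintegral_indicator (hYm hS), smul_eq_mul]
    have h := hC (S.indicator 1) (measurable_one.indicator hS)
    convert! h using 3
    · rename_i x
      by_cases hx : X x ∈ S
      · rw [Set.indicator_of_mem (show x ∈ X ⁻¹' S from hx), Set.indicator_of_mem hx]; simp
      · rw [Set.indicator_of_notMem (show x ∉ X ⁻¹' S from hx), Set.indicator_of_notMem hx]; simp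
    · ext x
      change _ = S.indicator 1 (Y x) * _
      by_cases hx : Y x ∈ S
      · rw [Set.indicator_of_mem (show x ∈ Y ⁻¹' S from hx), Set.indicator_of_mem hx]; simp
      · rw [Set.indicator_of_notMem (show x ∉ Y ⁻¹' S from hx), Set.indicator_of_notMem hx]; simp
  have hform : ∀ g : ℝ → ℝ, Measurable g → ∫ x, g (X x) ∂(spinLaw r n) =
      ((partitionFunction r n)⁻¹.toReal * C.toReal) *
        ∫ z, g (Y z) * tiltWeight b z ∂(gaussianProduct n) := by
    intro g hg
    rw [spinLaw, integral_smul_measure, ← integral_map hXm.aemeasurable hg.aestronglyMeasurable,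
      hlaw, integral_smul_measure, integral_map hYm.aemeasurable hg.aestronglyMeasurable,
      integral_withDensity_eq_integral_toReal_smul hGm (ae_of_all _ fun _ => ENNReal.ofReal_lt_top),
      smul_eq_mul, smul_eq_mul, mul_assoc]
    congr 2
    refine integral_congr_ae (ae_of_all _ fun z => ?_)
    simp only [smul_eq_mul]
    rw [ENNReal.toReal_ofReal tiltWeight_pos.le, mul_comm]
  have hone := hform (fun _ => 1) measurable_const
  have hprob : IsProbabilityMeasure (spinLaw r n) := isProbabilityMeasure_spinLaw hn
  simp only [integral_const, probReal_univ, one_smul, one_mul] at hone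
  have hne : ∫ z, tiltWeight b z ∂(gaussianProduct n) ≠ 0 := by
    intro h
    rw [h, mul_zero] at hone
    exact one_ne_zero hone
  rw [hform f hf, eq_div_iff hne]
  linear_combination -(∫ z, f (Y z) * tiltWeight b z ∂(gaussianProduct n)) * hone

/-! ### The variance equation -/

lemma continuous_symbol (r : ℕ) : Continuous (symbol r) := by
  unfold symbol; fun_prop

lemma continuous_inv_sub_symbol (r : ℕ) {s : ℝ} (hs : 1 < s) :
    Continuous fun t => (s - symbol r t)⁻¹ :=
  (continuous_const.sub (continuous_symbol r)).inv₀ fun t =>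
    (sub_pos.2 ((symbol_le_one r t).trans_lt hs)).ne'

/-- The integral `∫_0^1 (s - a(t))⁻¹ dt`; the variance equation asserts that it equals `1` at
`s = 1 + 1 / σ²`. -/
def resolventIntegral (r : ℕ) (s : ℝ) : ℝ := ∫ t in (0 : ℝ)..1, (s - symbol r t)⁻¹

lemma varianceEquation_iff (r : ℕ) (σ : ℝ) :
    VarianceEquation r σ ↔ resolventIntegral r (1 / σ ^ 2 + 1) = 1 := Iff.rfl

lemma resolventIntegral_strictAnti (r : ℕ) {s s' : ℝ} (hs : 1 < s) (hss' : s < s') :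
    resolventIntegral r s' < resolventIntegral r s := by
  have h : ∀ t, (s' - symbol r t)⁻¹ < (s - symbol r t)⁻¹ := fun t =>
    inv_strictAnti₀ (by linarith [symbol_le_one r t]) (by linarith)
  exact intervalIntegral.integral_lt_integral_of_continuousOn_of_le_of_exists_lt one_pos
    (continuous_inv_sub_symbol r (hs.trans hss')).continuousOn
    (continuous_inv_sub_symbol r hs).continuousOn (fun t _ => (h t).le)
    ⟨0, by simp, h 0⟩

lemma continuousOn_resolventIntegral (r : ℕ) {m : ℝ} (hm : 1 < m) :
    ContinuousOn (resolventIntegral r) (Set.Ici m) := by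
  have h : Continuous fun s : ℝ => ∫ t in (0 : ℝ)..1, (max s m - symbol r t)⁻¹ := by
    refine intervalIntegral.continuous_parametric_intervalIntegral_of_continuous' ?_ 0 1
    have := continuous_symbol r
    refine Continuous.inv₀ (by fun_prop) fun p => ?_
    have h1 := symbol_le_one r p.2
    have h2 := le_max_right p.1 m
    linarith
  refine h.continuousOn.congr fun s hs => ?_
  simp only [resolventIntegral, max_eq_left (Set.mem_Ici.1 hs)]

lemma one_sub_symbol_le {r : ℕ} (hr : 1 ≤ r) (t : ℝ) :
    1 - symbol r t ≤ 2 * (Real.pi * r) ^ 2 * t ^ 2 := by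
  have hr' : (0 : ℝ) < r := by exact_mod_cast hr
  have h1 : ∀ m ∈ Finset.Icc 1 r,
      1 - 2 * (Real.pi * r) ^ 2 * t ^ 2 ≤ Real.cos (2 * Real.pi * m * t) := by
    intro m hm
    have hmr : (m : ℝ) ≤ r := by exact_mod_cast (Finset.mem_Icc.1 hm).2
    have h2 := Real.one_sub_sq_div_two_le_cos (x := 2 * Real.pi * m * t)
    have h3 : (m : ℝ) ^ 2 ≤ r ^ 2 := pow_le_pow_left₀ (by positivity) hmr 2
    have h4 : (2 * Real.pi * m * t) ^ 2 / 2 = 2 * (Real.pi ^ 2 * t ^ 2) * m ^ 2 := by ring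
    have h5 := mul_le_mul_of_nonneg_left h3 (by positivity : 0 ≤ 2 * (Real.pi ^ 2 * t ^ 2))
    nlinarith
  have h2 := Finset.sum_le_sum h1
  simp only [Finset.sum_const, Nat.card_Icc, Nat.add_sub_cancel, nsmul_eq_mul] at h2
  have h3 := mul_le_mul_of_nonneg_left h2 (by positivity : (0 : ℝ) ≤ 1 / r)
  have h4 : 1 / (r : ℝ) * (r * (1 - 2 * (Real.pi * r) ^ 2 * t ^ 2)) =
      1 - 2 * (Real.pi * r) ^ 2 * t ^ 2 := by field_simp
  rw [h4] at h3
  unfold symbol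
  linarith

/-- The integral diverges as `s` decreases to `1`, because `1 - a(t) = O(t²)`. -/
lemma exists_one_le_resolventIntegral {r : ℕ} (hr : 1 ≤ r) :
    ∃ s : ℝ, 1 < s ∧ s ≤ 2 ∧ 1 ≤ resolventIntegral r s := by
  set c := 2 * (Real.pi * r) ^ 2 with hc
  have hc0 : 0 ≤ c := by positivity
  -- with `s = 1 + δ²` the integrand is at least `1 / (δ² (1 + c)) = 1 / δ` on `[0, δ]`
  set δ := 1 / (1 + c) with hδ
  have hδ0 : 0 < δ := by positivity
  have hδ1 : δ ≤ 1 := by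
    rw [hδ, div_le_one (by positivity)]; linarith
  have hδc : δ * (1 + c) = 1 := by rw [hδ]; field_simp
  refine ⟨1 + δ ^ 2, by nlinarith, by nlinarith, ?_⟩
  have hs : 1 < 1 + δ ^ 2 := by nlinarith
  have hcont := continuous_inv_sub_symbol r hs
  have hpos : ∀ t, 0 < (1 + δ ^ 2 - symbol r t)⁻¹ := fun t =>
    inv_pos.2 (by linarith [symbol_le_one r t])
  have h1 : ∫ _t in (0 : ℝ)..δ, 1 / δ = 1 := by
    rw [intervalIntegral.integral_const, smul_eq_mul]; field_simp; ring
  have h2 : ∫ _t in (0 : ℝ)..δ, 1 / δ ≤ ∫ t in (0 : ℝ)..δ, (1 + δ ^ 2 - symbol r t)⁻¹ := by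
    refine intervalIntegral.integral_mono_on hδ0.le (by simp) (hcont.intervalIntegrable _ _)
      fun t ht => ?_
    rw [one_div]
    refine inv_anti₀ (by linarith [symbol_le_one r t]) ?_
    have h3 := one_sub_symbol_le hr t
    have h4 : t ^ 2 ≤ δ ^ 2 := pow_le_pow_left₀ ht.1 ht.2 2
    rw [← hc] at h3
    have h5 := mul_le_mul_of_nonneg_left h4 hc0
    nlinarith
  have h3 : ∫ t in (0 : ℝ)..1, (1 + δ ^ 2 - symbol r t)⁻¹ =
      (∫ t in (0 : ℝ)..δ, (1 + δ ^ 2 - symbol r t)⁻¹) +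
        ∫ t in δ..1, (1 + δ ^ 2 - symbol r t)⁻¹ :=
    (intervalIntegral.integral_add_adjacent_intervals (hcont.intervalIntegrable _ _)
      (hcont.intervalIntegrable _ _)).symm
  have h4 : 0 ≤ ∫ t in δ..1, (1 + δ ^ 2 - symbol r t)⁻¹ :=
    intervalIntegral.integral_nonneg hδ1 fun t _ => (hpos t).le
  unfold resolventIntegral
  linarith

lemma resolventIntegral_two_le (r : ℕ) : resolventIntegral r 2 ≤ 1 := by
  have h : ∫ t in (0 : ℝ)..1, (2 - symbol r t)⁻¹ ≤ ∫ _t in (0 : ℝ)..1, (1 : ℝ) := by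
    refine intervalIntegral.integral_mono_on zero_le_one
      ((continuous_inv_sub_symbol r one_lt_two).intervalIntegrable _ _) (by simp) fun t _ => ?_
    exact inv_le_one_of_one_le₀ (by linarith [symbol_le_one r t])
  simpa [resolventIntegral] using h

lemma exists_resolventIntegral_eq_one {r : ℕ} (hr : 1 ≤ r) :
    ∃ s : ℝ, 1 < s ∧ resolventIntegral r s = 1 := by
  obtain ⟨m, hm1, hm2, hm⟩ := exists_one_le_resolventIntegral hr
  obtain ⟨s, hs, hs1⟩ := intermediate_value_Icc' hm2
    ((continuousOn_resolventIntegral r hm1).mono fun s hs => hs.1)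
    ⟨resolventIntegral_two_le r, hm⟩
  exact ⟨s, hm1.trans_le hs.1, hs1⟩

lemma varianceEquation_unique {r : ℕ} {σ τ : ℝ} (hσ : 0 < σ) (hτ : 0 < τ)
    (h : VarianceEquation r σ) (h' : VarianceEquation r τ) : τ = σ := by
  rw [varianceEquation_iff] at h h'
  have h1 : ∀ {x : ℝ}, 0 < x → 1 < 1 / x ^ 2 + 1 := fun {x} hx => by
    have : 0 < 1 / x ^ 2 := by positivity
    linarith
  rcases lt_trichotomy (1 / σ ^ 2 + 1) (1 / τ ^ 2 + 1) with hlt | heq | hgt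
  · have := resolventIntegral_strictAnti r (h1 hσ) hlt
    linarith
  · have h2 : 1 / τ ^ 2 = 1 / σ ^ 2 := by linarith
    have h3 : τ ^ 2 = σ ^ 2 := by
      rw [one_div, one_div] at h2
      exact inv_injective h2
    exact (pow_left_inj₀ hτ.le hσ.le two_ne_zero).1 h3
  · have := resolventIntegral_strictAnti r (h1 hτ) hgt
    linarith

/-- The integral of the Poisson kernel of the disc at the point `√2 - 1`. -/
lemma integral_inv_sqrt_two_sub_cos :
    ∫ θ in (0 : ℝ)..2 * Real.pi, (Real.sqrt 2 - Real.cos θ)⁻¹ = 2 * Real.pi := by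
  have h2 : Real.sqrt 2 * Real.sqrt 2 = 2 := Real.mul_self_sqrt (by norm_num)
  have h1 : 1 < Real.sqrt 2 := Real.lt_sqrt_of_sq_lt (by norm_num)
  have h3 : Real.sqrt 2 < 2 := by nlinarith
  set ρ : ℝ := Real.sqrt 2 - 1 with hρ
  have hw : (ρ : ℂ) ∈ Metric.ball (0 : ℂ) 1 := by
    rw [mem_ball_zero_iff, Complex.norm_real, Real.norm_eq_abs, abs_of_pos (by linarith)]
    linarith
  have h := DiffContOnCl.circleAverage_poissonKernel_smul (f := fun _ : ℂ => (1 : ℂ))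
    (c := 0) diffContOnCl_const hw
  have hk : ∀ θ : ℝ, poissonKernel 0 (ρ : ℂ) (circleMap 0 1 θ) =
      (Real.sqrt 2 - Real.cos θ)⁻¹ := by
    intro θ
    have hc := Real.cos_le_one θ
    have hn : ‖circleMap 0 1 θ - (ρ : ℂ)‖ ^ 2 = 1 + ρ ^ 2 - 2 * ρ * Real.cos θ := by
      rw [← Complex.normSq_eq_norm_sq, Complex.normSq_apply]
      simp only [circleMap, Complex.ofReal_one, one_mul, zero_add, Complex.sub_re, Complex.sub_im,
        Complex.exp_ofReal_mul_I_re, Complex.exp_ofReal_mul_I_im, Complex.ofReal_re,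
        Complex.ofReal_im]
      nlinarith [Real.sin_sq_add_cos_sq θ]
    have hm : ‖circleMap 0 1 θ‖ = 1 := by simp
    rw [poissonKernel_def, sub_zero, sub_zero, hn, hm, Complex.norm_real, Real.norm_eq_abs, sq_abs,
      ← one_div, div_eq_div_iff (by rw [hρ]; nlinarith) (by linarith)]
    rw [hρ]
    nlinarith
  simp only [Real.circleAverage, Pi.smul_apply', hk] at h
  have h4 : ∫ θ in (0 : ℝ)..2 * Real.pi, ((Real.sqrt 2 - Real.cos θ)⁻¹ • (1 : ℂ)) =
      ((∫ θ in (0 : ℝ)..2 * Real.pi, (Real.sqrt 2 - Real.cos θ)⁻¹ : ℝ) : ℂ) := by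
    rw [← intervalIntegral.integral_ofReal]
    simp
  rw [h4, Complex.real_smul, ← Complex.ofReal_mul] at h
  have h5 : (2 * Real.pi)⁻¹ * ∫ θ in (0 : ℝ)..2 * Real.pi, (Real.sqrt 2 - Real.cos θ)⁻¹ = 1 := by
    exact_mod_cast h
  exact ((inv_mul_eq_one₀ Real.two_pi_pos.ne').1 h5).symm

lemma varianceEquation_one : VarianceEquation 1 (Real.sqrt (Real.sqrt 2 + 1)) := by
  have h2 : Real.sqrt 2 * Real.sqrt 2 = 2 := Real.mul_self_sqrt (by norm_num)
  have h1 : 1 < Real.sqrt 2 := Real.lt_sqrt_of_sq_lt (by norm_num)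
  rw [varianceEquation_iff, Real.sq_sqrt (by positivity)]
  have h3 : 1 / (Real.sqrt 2 + 1) + 1 = Real.sqrt 2 := by
    field_simp
    linarith
  rw [h3]
  unfold resolventIntegral symbol
  have h4 := intervalIntegral.integral_comp_mul_left (a := 0) (b := 1)
    (fun θ => (Real.sqrt 2 - Real.cos θ)⁻¹) (c := 2 * Real.pi) (by positivity)
  rw [mul_zero, mul_one, integral_inv_sqrt_two_sub_cos, smul_eq_mul,
    inv_mul_cancel₀ (by positivity)] at h4
  simpa using h4

lemma abs_symbol_sub_symbol_le {r : ℕ} (hr : 1 ≤ r) (t t' : ℝ) :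
    |symbol r t - symbol r t'| ≤ 2 * Real.pi * r * |t - t'| := by
  have hr' : (0 : ℝ) < r := by exact_mod_cast hr
  have h1 : ∀ m ∈ Finset.Icc 1 r,
      |Real.cos (2 * Real.pi * m * t) - Real.cos (2 * Real.pi * m * t')| ≤
        2 * Real.pi * r * |t - t'| := by
    intro m hm
    have hmr : (m : ℝ) ≤ r := by exact_mod_cast (Finset.mem_Icc.1 hm).2
    refine (Real.abs_cos_sub_cos_le _ _).trans ?_
    rw [← mul_sub, abs_mul, abs_of_nonneg (by positivity)]
    gcongr
  unfold symbol
  rw [← mul_sub, ← Finset.sum_sub_distrib, abs_mul, abs_of_pos (by positivity)]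
  have h2 := (Finset.abs_sum_le_sum_abs _ _).trans (Finset.sum_le_sum h1)
  simp only [Finset.sum_const, Nat.card_Icc, Nat.add_sub_cancel, nsmul_eq_mul] at h2
  calc _ ≤ 1 / (r : ℝ) * (r * (2 * Real.pi * r * |t - t'|)) :=
        mul_le_mul_of_nonneg_left h2 (by positivity)
    _ = _ := by field_simp

lemma abs_inv_sub_symbol_sub_le {r : ℕ} (hr : 1 ≤ r) {s : ℝ} (hs : 1 < s) (t t' : ℝ) :
    |(s - symbol r t)⁻¹ - (s - symbol r t')⁻¹| ≤
      2 * Real.pi * r / (s - 1) ^ 2 * |t - t'| := by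
  have h1 : s - 1 ≤ s - symbol r t := by linarith [symbol_le_one r t]
  have h2 : s - 1 ≤ s - symbol r t' := by linarith [symbol_le_one r t']
  have h0 : 0 < s - 1 := by linarith
  have h3 : (s - 1) ^ 2 ≤ (s - symbol r t) * (s - symbol r t') := by nlinarith
  rw [inv_sub_inv (by linarith) (by linarith), abs_div,
    abs_of_pos (mul_pos (h0.trans_le h1) (h0.trans_le h2)), div_mul_eq_mul_div]
  refine div_le_div₀ (by positivity) ?_ (by positivity) h3
  rw [sub_sub_sub_cancel_left]
  exact abs_symbol_sub_symbol_le hr t t'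

/-! ### Riemann sums -/

/-- The error of a Riemann sum of a Lipschitz function. -/
lemma abs_sum_sub_integral_le {f : ℝ → ℝ} {Λ : ℝ} (hf : Continuous f)
    (hΛ : ∀ x y, |f x - f y| ≤ Λ * |x - y|) {n : ℕ} (hn : 0 < n) :
    |∑ k ∈ Finset.range n, f (k / n) - n * ∫ t in (0 : ℝ)..1, f t| ≤ Λ := by
  have hn' : (0 : ℝ) < n := by exact_mod_cast hn
  have hΛ0 : 0 ≤ Λ := by
    have := (abs_nonneg _).trans (hΛ 1 0)
    simpa using this
  have h1 := intervalIntegral.sum_integral_adjacent_intervals (f := f) (μ := volume)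
    (a := fun k : ℕ => (k : ℝ) / n) (n := n) fun k _ => hf.intervalIntegrable _ _
  simp only [Nat.cast_zero, zero_div, div_self hn'.ne'] at h1
  rw [← h1, Finset.mul_sum, ← Finset.sum_sub_distrib]
  have h2 : ∀ k ∈ Finset.range n, |f (k / n) -
      n * ∫ t in ((k : ℝ) / n)..(((k + 1 : ℕ) : ℝ) / n), f t| ≤ Λ / n := by
    intro k _
    have hlen : ((k + 1 : ℕ) : ℝ) / n - k / n = 1 / n := by push_cast; ring
    have hle : (k : ℝ) / n ≤ ((k + 1 : ℕ) : ℝ) / n := by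
      have : (0 : ℝ) < 1 / n := by positivity
      linarith
    have h3 : f (k / n) - n * ∫ t in ((k : ℝ) / n)..(((k + 1 : ℕ) : ℝ) / n), f t =
        n * ∫ t in ((k : ℝ) / n)..(((k + 1 : ℕ) : ℝ) / n), (f (k / n) - f t) := by
      rw [intervalIntegral.integral_sub (by simp) (hf.intervalIntegrable _ _),
        intervalIntegral.integral_const, hlen, smul_eq_mul, mul_sub]
      field_simp
    have h4 : ‖∫ t in ((k : ℝ) / n)..(((k + 1 : ℕ) : ℝ) / n), (f (k / n) - f t)‖ ≤
        Λ * (1 / n) * |((k + 1 : ℕ) : ℝ) / n - k / n| := by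
      refine intervalIntegral.norm_integral_le_of_norm_le_const fun t ht => ?_
      rw [Set.uIoc_of_le hle] at ht
      refine (hΛ _ _).trans (mul_le_mul_of_nonneg_left ?_ hΛ0)
      rw [abs_le]
      constructor <;> linarith [ht.1, ht.2]
    rw [hlen, abs_of_pos (by positivity : (0 : ℝ) < 1 / n), Real.norm_eq_abs] at h4
    rw [h3, abs_mul, abs_of_pos hn']
    calc _ ≤ (n : ℝ) * (Λ * (1 / n) * (1 / n)) := mul_le_mul_of_nonneg_left h4 hn'.le
      _ = Λ / n := by field_simp
  refine (Finset.abs_sum_le_sum_abs _ _).trans ((Finset.sum_le_sum h2).trans ?_)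
  simp only [Finset.sum_const, Finset.card_range, nsmul_eq_mul]
  exact (mul_div_cancel₀ _ hn'.ne').le

lemma abs_sum_one_sub_modeVariance_le {r : ℕ} (hr : 1 ≤ r) {s : ℝ} (hs : 1 < s)
    (h1 : resolventIntegral r s = 1) {n : ℕ} (hn : 0 < n) :
    |∑ k, (1 - modeVariance r n s k)| ≤ 2 * Real.pi * r / (s - 1) ^ 2 := by
  have h := abs_sum_sub_integral_le (continuous_inv_sub_symbol r hs)
    (abs_inv_sub_symbol_sub_le hr hs) hn
  change |_ - (n : ℝ) * resolventIntegral r s| ≤ _ at h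
  rw [h1, abs_sub_comm] at h
  have h2 : ∑ k, (1 - modeVariance r n s k) =
      (n : ℝ) * 1 - ∑ k ∈ Finset.range n, (s - symbol r ((k : ℕ) / n))⁻¹ := by
    rw [Finset.sum_sub_distrib,
      ← Fin.sum_univ_eq_sum_range (fun k : ℕ => (s - symbol r ((k : ℕ) / n))⁻¹)]
    simp [modeVariance]
  rwa [h2]

/-! ### The central limit theorem -/

lemma modeVariance_zero {r n : ℕ} (hr : 1 ≤ r) (hn : 0 < n) (s : ℝ) :
    modeVariance r n s ⟨0, hn⟩ = (s - 1)⁻¹ := by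
  have hr' : (r : ℝ) ≠ 0 := by exact_mod_cast (Nat.one_le_iff_ne_zero.1 hr)
  simp [modeVariance, symbol, hr']

lemma integral_comp_mul_eval_gaussianProduct {n : ℕ} (i : Fin n) (c : ℝ) {f : ℝ → ℝ}
    (hf : Measurable f) :
    ∫ z, f (c * z i) ∂(gaussianProduct n) = ∫ x, f x ∂(gaussianReal 0 (c ^ 2).toNNReal) := by
  have h := gaussianReal_map_const_mul (μ := 0) (v := 1) c
  have hv : NNReal.mk (c ^ 2) (sq_nonneg c) * 1 = (c ^ 2).toNNReal := by
    ext; simp [Real.coe_toNNReal _ (sq_nonneg c)]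
  rw [mul_zero, hv] at h
  rw [← h, integral_map (by fun_prop) hf.aestronglyMeasurable]
  unfold gaussianProduct
  exact integral_comp_eval (μ := fun _ : Fin n => gaussianReal 0 1) (f := fun x => f (c * x))
    (hf.comp (measurable_const_mul c)).aestronglyMeasurable

/-- The central limit theorem for the magnetization, with the limiting variance in the form
`(s - 1)⁻¹`. -/
lemma tendstoInDistribution_magnetization {r : ℕ} (hr : 1 ≤ r) {s : ℝ} (hs : 1 < s)
    (h1 : resolventIntegral r s = 1) :
    TendstoInDistribution
        (fun (n : Set.Ioi (2 * r)) (x : Fin n → ℝ) => magnetization n x / Real.sqrt (n : ℕ))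
        atTop (id : ℝ → ℝ) (fun n : Set.Ioi (2 * r) => spinLaw r n)
        (gaussianReal 0 ((s - 1)⁻¹).toNNReal) := by
  have hXm : ∀ n : ℕ, Measurable fun x : Fin n → ℝ => magnetization n x / Real.sqrt n := by
    intro n; unfold magnetization; fun_prop
  refine ⟨fun n => (hXm n).aemeasurable, aemeasurable_id, ?_⟩
  refine tendsto_iff_forall_lipschitz_integral_tendsto.2 ?_
  rintro f ⟨D, hD⟩ ⟨L, hL⟩
  have hfm : Measurable f := hL.continuous.measurable
  have hB : ∀ x, |f x| ≤ |f 0| + D := by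
    intro x
    have h2 := hD x 0
    rw [Real.dist_eq] at h2
    have h3 : f x = f 0 + (f x - f 0) := by ring
    rw [h3]
    exact (abs_add_le _ _).trans (by linarith)
  have hs0 : 0 < s - 1 := by linarith
  have hs1 : 0 < s + 1 := by linarith
  obtain ⟨C, hC⟩ := exists_abs_tilted_sub_le (K := 2 * Real.pi * r / (s - 1) ^ 2)
    (inv_pos.2 hs1) (inv_anti₀ hs0 (by linarith)) hB hL
  simp only [ProbabilityMeasure.coe_mk, Measure.map_id]
  rw [tendsto_iff_norm_sub_tendsto_zero]
  have hlim : Tendsto (fun n : Set.Ioi (2 * r) => C / Real.sqrt ((n : ℕ) : ℝ)) atTop (𝓝 0) := by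
    have h2 : Tendsto (fun n : ℕ => C / Real.sqrt (n : ℝ)) atTop (𝓝 0) :=
      Tendsto.const_div_atTop (Real.tendsto_sqrt_atTop.comp tendsto_natCast_atTop_atTop) C
    exact h2.comp (tendsto_comp_val_Ioi_atTop.2 tendsto_id)
  refine squeeze_zero (fun _ => norm_nonneg _) (fun n => ?_) hlim
  have hn : 0 < (n : ℕ) := lt_of_le_of_lt (Nat.zero_le _) n.2
  have hk := hC n hn (modeVariance r n s) ⟨0, hn⟩
    (fun k => inv_anti₀ (by linarith [symbol_le_one r ((k : ℕ) / (n : ℕ))])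
      (by linarith [neg_one_le_symbol r ((k : ℕ) / (n : ℕ))]))
    (fun k => inv_anti₀ hs0 (by linarith [symbol_le_one r ((k : ℕ) / (n : ℕ))]))
    (abs_sum_one_sub_modeVariance_le hr hs h1 hn)
  rw [← integral_spinLaw_eq hn r hs hfm, integral_comp_mul_eval_gaussianProduct _ _ hfm,
    Real.sq_sqrt (modeVariance_pos r n hs _).le, modeVariance_zero hr hn] at hk
  rw [integral_map (hXm n).aemeasurable hfm.aestronglyMeasurable, Real.norm_eq_abs]
  exact hk

end

end SpinChain


theorem theorem3 (r : ℕ) (hr : 1 ≤ r) :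
    ∃ σ : ℝ, 0 < σ ∧ SpinChain.VarianceEquation r σ ∧
      (∀ τ : ℝ, 0 < τ → SpinChain.VarianceEquation r τ → τ = σ) ∧
      TendstoInDistribution
        (fun (n : Set.Ioi (2 * r)) (x : Fin n → ℝ) =>
          SpinChain.magnetization n x / Real.sqrt (n : ℕ))
        atTop (id : ℝ → ℝ)
        (fun n : Set.Ioi (2 * r) => SpinChain.spinLaw r n)
        (gaussianReal 0 (σ ^ 2).toNNReal) ∧
      (r = 1 → σ ^ 2 = Real.sqrt 2 + 1) := by
  obtain ⟨s, hs, hs1⟩ := SpinChain.exists_resolventIntegral_eq_one hr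
  have hs0 : 0 < (s - 1)⁻¹ := inv_pos.2 (by linarith)
  have hσ2 : Real.sqrt (s - 1)⁻¹ ^ 2 = (s - 1)⁻¹ := Real.sq_sqrt hs0.le
  have hσ : 0 < Real.sqrt (s - 1)⁻¹ := Real.sqrt_pos.2 hs0
  have heq : SpinChain.VarianceEquation r (Real.sqrt (s - 1)⁻¹) := by
    rw [SpinChain.varianceEquation_iff, hσ2, one_div, inv_inv, sub_add_cancel]
    exact hs1
  refine ⟨Real.sqrt (s - 1)⁻¹, hσ, heq, fun τ hτ h => SpinChain.varianceEquation_unique hσ hτ heq h,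
    ?_, ?_⟩
  · rw [hσ2]
    exact SpinChain.tendstoInDistribution_magnetization hr hs hs1
  · rintro rfl
    rw [← SpinChain.varianceEquation_unique hσ (Real.sqrt_pos.2 (by positivity)) heq
      SpinChain.varianceEquation_one, Real.sq_sqrt (by positivity)]
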